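/- **Conventions.** A planar map is a finite connected multigraph (loops and multiple edges allowed) cellularly embedded in the sphere, up to orientation-preserving homeomorphism. A corner is identified with the oriented edge that leaves its vertex with the corner directly to its right. A rooted map is a map with a distinguished corner $\rho$ (equivalently an oriented root edge). Let $n\ge 1$. $\mathcal M_n$ is the set of rooted planar maps with $n$ edges, and $\mathcal Q_n$ the set of rooted quadrangulations (all faces of degree $4$) with $n$ faces. *Tutte's mapping* $\mathcal M_n\to\mathcal Q_n$: given $m\in\mathcal M_n$, draw a new vertex in each face, join it without crossings to every corner of that face, and erase the original edges; the root edge is the edge issued from the root corner of $m$, oriented away from it. Thus the edges of the quadrangulation correspond bijectively to the corners of $m$. *Rotations.* For $m\in\mathcal M_n$, a corner $c\ne\rho$ in a face $f_c$ and $s\in\{+,-\}$, let $c_-,c_+$ be the corners before and after $c$ in the clockwise contour of $f_c$, and let $e_-,e_+$ be the edges of $f_c$ joining $c_-$ to $c$ and $c$ to $c_+$. Draw in $f_c$ an edge $e_=$ joining $c_-$ to $c_+$, creating a triangle $e_-,e_+,e_=$ that contains $c$ (if $\deg f_c=1$, instead join the vertex of $c$ to a new vertex inside the loop $e_-=e_+$).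 Then erase $e_s$ and any vertex adjacent only to $e_s$. If $\rho\in\{c_-,c_+\}$, the new root corner is the part of $\rho$ outside the triangle; otherwise it is the corner containing $\rho$ (in either case enlarged if erasing $e_s$ enlarges it). The result is $m^{c,s}$. *Flips.* For $q\in\mathcal Q_n$ with root edge $\rho$, an edge $e\neq\rho$ and $s\in\{+,-\}$: if $e$ separates two distinct faces, $q^{e,+}$ (resp. $q^{e,-}$) is obtained by erasing $e$ and replacing it with the edge obtained by rotating $e$ clockwise (resp. counterclockwise) by one corner in the resulting hexagon. If $e$ has the same face on both sides, let $w$ be its endpoint of degree $1$ and $v$ the vertex of that face that is not an endpoint of $e$; then $q^{e,+}=q^{e,-}$ is obtained by replacing $e$ with an edge joining $v$ and $w$ within that face. The root is unchanged. *Chains.* The edge rotation chain on $\mathcal M_n$ and the non-root edge flip chain on $\mathcal Q_n$ have transition probabilities $$p_{\mathcal R}(m,m')=\frac1{3(2n-1)}\sum_{c\neq\rho}\left(1_{m'=m^{c,+}}+1_{m'=m^{c,-}}+1_{m'=m}\right),\qquad p_{\mathcal F}(q,q')=\frac1{3(2n-1)}\sum_{e\neq\rho}\left(1_{q'=q^{e,+}}+1_{q'=q^{e,-}}+1_{q'=q}\right),$$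 where the sums run over the corners of $m$ other than the root corner and over the edges of $q$ other than the root edge. **Statement.** Let $n\ge1$. Tutte's mapping is a bijection $\mathcal M_n\to\mathcal Q_n$; let $\Phi:\mathcal Q_n\to\mathcal M_n$ be its inverse. For every $q\in\mathcal Q_n$ with root edge $\rho$, every edge $e\ne\rho$ of $q$ and every $s\in\{+,-\}$, let $c$ be the corner of $\Phi(q)$ corresponding to $e$ (the corner that $e$ is issued from). Then $c$ is not the root corner of $\Phi(q)$, $q^{e,s}\in\mathcal Q_n$, $\Phi(q)^{c,s}\in\mathcal M_n$, and $$\Phi(q^{e,s})=\Phi(q)^{c,s}.$$ Consequently the non-root edge flip chain and the edge rotation chain are isomorphic Markov chains: $p_{\mathcal F}$ and $p_{\mathcal R}$ are stochastic matrices, and $p_{\mathcal F}(q,q')=p_{\mathcal R}(\Phi(q),\Phi(q'))$ for all $q,q'\in\mathcal Q_n$. -/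

import Mathlib

/-!
Rooted planar maps are encoded as combinatorial maps (rotation systems): a finite set of darts
(oriented edges), the permutation `rot` sending a dart to the next dart in counterclockwise order
around its tail, and the fixed-point-free involution `rev` reversing a dart.  A connected
combinatorial map of genus zero, up to relabelling of its darts, is the same thing as a connected
graph cellularly embedded in the sphere, up to orientation-preserving homeomorphism.
-/

namespace MapChains

open Equiv

/-- A rooted combinatorial map on the set of darts `D`.  The dart `d` also stands for the corner
which lies at the tail of `d`, directly to the right of `d`, i.e. the corner between `rot⁻¹ d`
and `d`. -/
structure RootedMap (D : Type*) where
  /-- next dart counterclockwise around the tail -/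
  rot : Perm D
  /-- the same edge with the opposite orientation -/
  rev : Perm D
  rev_rev : ∀ d, rev (rev d) = d
  rev_ne : ∀ d, rev d ≠ d
  /-- the root dart, equivalently the root corner -/
  root : D

/-- The two directions: `plus` (clockwise) and `minus` (counterclockwise). -/
inductive Dir
  | plus
  | minus

namespace RootedMap

variable {D D' : Type*}

/-- Next corner in the clockwise contour of the face of a corner; equivalently, next dart along
the boundary of the face that lies to the right of a dart. -/
def faceNext (m : RootedMap D) : Perm D := m.rot * m.rev

def Vertex (m : RootedMap D) : Type _ := Quotient (Perm.SameCycle.setoid m.rot)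
def Edge (m : RootedMap D) : Type _ := Quotient (Perm.SameCycle.setoid m.rev)
def Face (m : RootedMap D) : Type _ := Quotient (Perm.SameCycle.setoid m.faceNext)

/-- The edge underlying a dart. -/
def edge (m : RootedMap D) (d : D) : m.Edge := Quotient.mk _ d

def rootEdge (m : RootedMap D) : m.Edge := m.edge m.root

def IsConnected (m : RootedMap D) : Prop :=
  ∀ x y, Relation.ReflTransGen (fun a b => b = m.rot a ∨ b = m.rev a) x y

/-- Connected and of genus zero (Euler's formula). -/
structure IsPlanarMap (m : RootedMap D) : Prop where
  connected : m.IsConnected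
  euler : Nat.card m.Vertex + Nat.card m.Face = Nat.card m.Edge + 2

/-- The degree of the face containing the corner `d`: the length of its cyclic contour. -/
noncomputable def faceDegree (m : RootedMap D) (d : D) : ℕ :=
  Function.minimalPeriod m.faceNext d

/-- A planar map all of whose faces have degree `4`. -/
structure IsQuadrangulation (m : RootedMap D) : Prop extends m.IsPlanarMap where
  degree : ∀ d, m.faceDegree d = 4

/-- `g` is an isomorphism of rooted maps. -/
structure IsIso (m : RootedMap D) (m' : RootedMap D') (g : D ≃ D') : Prop where
  rot : ∀ d, g (m.rot d) = m'.rot (g d)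
  rev : ∀ d, g (m.rev d) = m'.rev (g d)
  root : g m.root = m'.root

/-- Two labelled rooted maps represent the same rooted map. -/
def Iso (m : RootedMap D) (m' : RootedMap D') : Prop := ∃ g : D ≃ D', m.IsIso m' g

end RootedMap

/-! ### Moving the end of an edge -/

section Surgery

variable {D : Type*} [DecidableEq D]

/-- Remove `d` from its cycle (it becomes a fixed point). -/
def detach (σ : Perm D) (d : D) : Perm D := σ * swap (σ⁻¹ d) d

/-- Insert the fixed point `d` immediately after `x` in the cycle of `x`
(if `x = d`, then `d` is left as a fixed point). -/
def insertAfter (σ : Perm D) (d x : D) : Perm D := σ * swap x d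

/-- Insert the fixed point `d` immediately before `z` in the cycle of `z`, that is, within the
corner `z` (if `z = d`, then `d` is left as a fixed point). -/
def insertBefore (σ : Perm D) (d z : D) : Perm D := insertAfter σ d (σ⁻¹ z)

end Surgery

namespace RootedMap

variable {D D' : Type*}

section Operations

variable [DecidableEq D]

/-- The edge rotation `m^{c,s}`.

The corner `c` lies between the darts `rot⁻¹ c` (an end of `e₋`) and `c` (an end of `e₊`); the
corners before and after it in the clockwise contour of its face are
`c₋ = faceNext⁻¹ c = rev (rot⁻¹ c)` and `c₊ = faceNext c = rot (rev c)`.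

* `s = +`: the edge `e₊ = {c, rev c}` is replaced by the edge `e₌` which joins `c₊` to `c₋`: the
  end `rev c` of `e₊` stays where it is, while the end `c` is detached from the vertex of `c` and
  inserted in the corner `c₋`, immediately before the dart `rev (rot⁻¹ c)`.  If the root corner
  is `c₋`, then the new root corner is the part of `c₋` not in the triangle `e₋, e₊, e₌`; this is
  the corner to the right of the new dart `c`.
* `s = -`: the edge `e₋ = {rot⁻¹ c, rev (rot⁻¹ c)}` is replaced by `e₌`: its end `rot⁻¹ c` is
  detached and inserted in the corner `c₊`, immediately after `rev c`.  If the root corner was to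
  the right of `rot⁻¹ c`, then it gets merged with the corner to the right of `c`.

When the face of `c` has degree `1`, then `rev (rot⁻¹ c) = c` and `rev c = rot⁻¹ c`, so that the
detached end becomes a new vertex of degree `1`.  When the vertex of `c` has degree `1`, this
vertex disappears and the rotated edge becomes a loop. -/
def rotate (m : RootedMap D) (c : D) : Dir → RootedMap D
  | .plus =>
    { m with
      rot := insertBefore (detach m.rot c) c (m.rev (m.rot⁻¹ c))
      root := if m.root = m.rev (m.rot⁻¹ c) then c else m.root }
  | .minus =>
    { m with
      rot := insertAfter (detach m.rot (m.rot⁻¹ c)) (m.rot⁻¹ c) (m.rev c)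
      root := if m.root = m.rot⁻¹ c then c else m.root }

/-- When the oriented edge `d` separates two faces of degree `4` and is rotated in the given
direction within the resulting hexagon, its head moves to this corner of the hexagon. -/
def flipTarget (q : RootedMap D) (d : D) : Dir → D
  | .plus => q.faceNext (q.faceNext d)
  | .minus => q.faceNext (q.faceNext (q.faceNext d))

open Classical in
/-- The rotation system after flipping the edge that underlies the dart `d`.

If the edge has distinct faces on its two sides, both its ends move by one corner along the
contour of the hexagon obtained by erasing it.  Otherwise the edge is internal to a degenerate
face: its end of degree `1` is kept and its other end moves to the opposite corner of that face.
(The last case does not occur in a quadrangulation.) -/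
noncomputable def flipRot (q : RootedMap D) (d : D) (s : Dir) : Perm D :=
  if ¬ q.faceNext.SameCycle d (q.rev d) then
    insertBefore (insertBefore (detach (detach q.rot d) (q.rev d))
      (q.rev d) (q.flipTarget d s)) d (q.flipTarget (q.rev d) s)
  else if q.rot d = d then
    insertBefore (detach q.rot (q.rev d)) (q.rev d) (q.faceNext (q.faceNext d))
  else if q.rot (q.rev d) = q.rev d then
    insertBefore (detach q.rot d) d (q.faceNext (q.faceNext (q.rev d)))
  else q.rot

/-- Flip of the edge underlying the dart `d`; the root dart is kept. -/
noncomputable def flipDart (q : RootedMap D) (d : D) (s : Dir) : RootedMap D :=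
  { q with rot := q.flipRot d s }

end Operations

/-- Tutte's construction.  The edges of the quadrangulation are in bijection with the corners of
`m`: the dart `(c, false)` goes from the vertex of the corner `c` to the new vertex drawn in the
face of `c`, and `(c, true)` is its reverse.  Around an old vertex the edges are ordered as the
corners of this vertex; around a new vertex, the counterclockwise order is that of the
counterclockwise contour of the face.  The root is the edge issued from the root corner. -/
def tutteMap (m : RootedMap D) : RootedMap (D × Bool) where
  rot :=
    { toFun := fun x => (if x.2 then m.faceNext⁻¹ x.1 else m.rot x.1, x.2)
      invFun := fun x => (if x.2 then m.faceNext x.1 else m.rot⁻¹ x.1, x.2)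
      left_inv := by rintro ⟨d, _ | _⟩ <;> simp
      right_inv := by rintro ⟨d, _ | _⟩ <;> simp }
  rev :=
    { toFun := fun x => (x.1, !x.2)
      invFun := fun x => (x.1, !x.2)
      left_inv := by rintro ⟨d, b⟩; simp
      right_inv := by rintro ⟨d, b⟩; simp }
  rev_rev := by rintro ⟨d, b⟩; simp
  rev_ne := by rintro ⟨d, b⟩; simp
  root := (m.root, false)

/-- Transport of a map along a relabelling of the darts. -/
def relabel (m : RootedMap D) (g : D ≃ D') : RootedMap D' where
  rot := g.permCongr m.rot
  rev := g.permCongr m.rev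
  rev_rev := by simp [permCongr_apply, m.rev_rev]
  rev_ne := by
    intro d h
    apply m.rev_ne (g.symm d)
    apply g.injective
    simpa [permCongr_apply] using h
  root := g m.root

/-! ### Facts needed for the definitions -/

@[ext] theorem ext' {m m' : RootedMap D} (h1 : m.rot = m'.rot) (h2 : m.rev = m'.rev)
    (h3 : m.root = m'.root) : m = m' := by
  cases m; cases m'; simp_all

theorem isIso_relabel (m : RootedMap D) (g : D ≃ D') : m.IsIso (m.relabel g) g :=
  ⟨by simp [relabel, permCongr_apply], by simp [relabel, permCongr_apply], rfl⟩

theorem IsIso.eq_relabel {m : RootedMap D} {m' : RootedMap D'} {g : D ≃ D'} (h : m.IsIso m' g) :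
    m' = m.relabel g := by
  apply ext'
  · ext x; simp [relabel, permCongr_apply, h.rot]
  · ext x; simp [relabel, permCongr_apply, h.rev]
  · exact h.root.symm

theorem IsIso.refl (m : RootedMap D) : m.IsIso m (Equiv.refl D) := ⟨by simp, by simp, rfl⟩

theorem IsIso.symm {m : RootedMap D} {m' : RootedMap D'} {g : D ≃ D'} (h : m.IsIso m' g) :
    m'.IsIso m g.symm :=
  ⟨fun d => by rw [symm_apply_eq, h.rot, apply_symm_apply],
   fun d => by rw [symm_apply_eq, h.rev, apply_symm_apply], by simp [← h.root]⟩

theorem IsIso.trans {D'' : Type*} {m : RootedMap D} {m' : RootedMap D'} {m'' : RootedMap D''}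
    {g : D ≃ D'} {g' : D' ≃ D''} (h : m.IsIso m' g) (h' : m'.IsIso m'' g') :
    m.IsIso m'' (g.trans g') :=
  ⟨by simp [h.rot, h'.rot], by simp [h.rev, h'.rev], by simp [h.root, h'.root]⟩

theorem Iso.refl (m : RootedMap D) : m.Iso m := ⟨_, IsIso.refl m⟩

theorem Iso.symm {m : RootedMap D} {m' : RootedMap D'} (h : m.Iso m') : m'.Iso m :=
  ⟨_, h.choose_spec.symm⟩

theorem Iso.trans {D'' : Type*} {m : RootedMap D} {m' : RootedMap D'} {m'' : RootedMap D''}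
    (h : m.Iso m') (h' : m'.Iso m'') : m.Iso m'' := ⟨_, h.choose_spec.trans h'.choose_spec⟩

theorem sameCycle_permCongr (g : D ≃ D') (p : Perm D) (x y : D) :
    (g.permCongr p).SameCycle (g x) (g y) ↔ p.SameCycle x y := by
  have key : ∀ i : ℤ, (g.permCongr p ^ i) (g x) = g ((p ^ i) x) := by
    intro i
    have : g.permCongr p ^ i = g.permCongr (p ^ i) := by
      rw [← permCongrHom_coe g, map_zpow]
    rw [this]; simp [permCongr_apply]
  simp only [Perm.SameCycle, key, g.injective.eq_iff]

theorem relabel_faceNext (m : RootedMap D) (g : D ≃ D') :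
    (m.relabel g).faceNext = g.permCongr m.faceNext := by
  ext x; simp [faceNext, relabel, permCongr_apply]


/-- The quotient of a relabelled set of darts. -/
theorem card_quotient_congr {s : Setoid D} {s' : Setoid D'} (f : D → D')
    (hf : ∀ x y, s x y ↔ s' (f x) (f y)) (hs : ∀ y, ∃ x, s' (f x) y) :
    Nat.card (Quotient s) = Nat.card (Quotient s') := by
  refine Nat.card_congr (Equiv.ofBijective
    (Quotient.map f (fun x y h => (hf x y).1 h)) ⟨?_, ?_⟩)
  · rintro ⟨x⟩ ⟨y⟩ h
    exact Quotient.sound ((hf x y).2 (Quotient.exact h))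
  · rintro ⟨y⟩
    obtain ⟨x, hx⟩ := hs y
    exact ⟨Quotient.mk _ x, Quotient.sound hx⟩

theorem card_cycles_permCongr (g : D ≃ D') (p : Perm D) :
    Nat.card (Quotient (Perm.SameCycle.setoid (g.permCongr p))) =
      Nat.card (Quotient (Perm.SameCycle.setoid p)) :=
  (card_quotient_congr g (fun x y => (sameCycle_permCongr g p x y).symm)
    (fun y => ⟨g.symm y, by rw [apply_symm_apply]⟩)).symm

theorem IsPlanarMap.relabel {m : RootedMap D} (h : m.IsPlanarMap) (g : D ≃ D') :
    (m.relabel g).IsPlanarMap where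
  connected := by
    intro x y
    have := (h.connected (g.symm x) (g.symm y)).lift g
      (p := fun a b => b = (m.relabel g).rot a ∨ b = (m.relabel g).rev a) (by
        rintro a b (rfl | rfl) <;> simp [Function.onFun, RootedMap.relabel, permCongr_apply])
    simpa [Function.onFun] using this
  euler := by
    have hE := h.euler
    unfold Vertex Face Edge at *
    rw [relabel_faceNext, card_cycles_permCongr]
    simp only [RootedMap.relabel]
    rw [card_cycles_permCongr, card_cycles_permCongr, hE]

theorem faceDegree_relabel (m : RootedMap D) (g : D ≃ D') (d : D) :
    (m.relabel g).faceDegree (g d) = m.faceDegree d := by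
  unfold faceDegree
  rw [relabel_faceNext]
  have key : ∀ k : ℕ, (g.permCongr m.faceNext)^[k] (g d) = g (m.faceNext^[k] d) := by
    intro k
    exact ((Function.Semiconj.iterate_right
      (show Function.Semiconj g m.faceNext (g.permCongr m.faceNext) from
        fun x => by simp [permCongr_apply]) k) d).symm
  refine Function.minimalPeriod_eq_minimalPeriod_iff.2 fun k => ?_
  simp only [Function.IsPeriodicPt, Function.IsFixedPt, key, g.injective.eq_iff]

theorem IsQuadrangulation.relabel {m : RootedMap D} (h : m.IsQuadrangulation) (g : D ≃ D') :
    (m.relabel g).IsQuadrangulation where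
  toIsPlanarMap := h.toIsPlanarMap.relabel g
  degree := fun d => by
    obtain ⟨d, rfl⟩ := g.surjective d
    rw [faceDegree_relabel, h.degree]

/-! Tutte's construction yields quadrangulations. -/

@[simp] theorem tutteMap_rot_false (m : RootedMap D) (d : D) :
    m.tutteMap.rot (d, false) = (m.rot d, false) := rfl
@[simp] theorem tutteMap_rot_true (m : RootedMap D) (d : D) :
    m.tutteMap.rot (d, true) = (m.faceNext⁻¹ d, true) := rfl
@[simp] theorem tutteMap_rev (m : RootedMap D) (d : D) (b : Bool) :
    m.tutteMap.rev (d, b) = (d, !b) := rfl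

theorem rev_inv (m : RootedMap D) : m.rev⁻¹ = m.rev := by
  ext d; rw [Perm.inv_eq_iff_eq, m.rev_rev]

theorem faceNext_inv_apply (m : RootedMap D) (d : D) :
    m.faceNext⁻¹ d = m.rev (m.rot⁻¹ d) := by
  simp [faceNext, mul_inv_rev, rev_inv]

theorem tutteMap_connected {m : RootedMap D} (h : m.IsConnected) : m.tutteMap.IsConnected := by
  set R : D × Bool → D × Bool → Prop :=
    fun a b => b = m.tutteMap.rot a ∨ b = m.tutteMap.rev a with hR
  have s1 : ∀ d b, Relation.ReflTransGen R (d, b) (d, !b) :=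
    fun d b => Relation.ReflTransGen.single (Or.inr rfl)
  have s2 : ∀ d, Relation.ReflTransGen R (d, false) (m.rot d, false) :=
    fun d => Relation.ReflTransGen.single (Or.inl rfl)
  have s3 : ∀ d, Relation.ReflTransGen R (d, false) (m.rev d, false) := fun d => by
    refine ((s2 d).trans (s1 _ _)).trans ?_
    refine Relation.ReflTransGen.trans (b := (m.rev d, true))
      (Relation.ReflTransGen.single (Or.inl ?_)) (s1 _ _)
    simp [faceNext_inv_apply]
  have s4 : ∀ x y, Relation.ReflTransGen R (x, false) (y, false) := fun x y => by
    have := h x y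
    induction this with
    | refl => exact .refl
    | tail _ hs ih =>
      rcases hs with rfl | rfl
      · exact ih.trans (s2 _)
      · exact ih.trans (s3 _)
  rintro ⟨x, _ | _⟩ ⟨y, _ | _⟩
  · exact s4 x y
  · exact (s4 x y).trans (s1 _ _)
  · exact (s1 x true).trans (s4 x y)
  · exact ((s1 x true).trans (s4 x y)).trans (s1 _ _)

theorem tutteMap_faceNext_false (m : RootedMap D) (d : D) :
    m.tutteMap.faceNext (d, false) = (m.rev (m.rot⁻¹ d), true) := by
  rw [← faceNext_inv_apply]; rfl

theorem tutteMap_faceNext_true (m : RootedMap D) (d : D) :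
    m.tutteMap.faceNext (d, true) = (m.rot d, false) := rfl

theorem tutteMap_faceDegree (m : RootedMap D) (x : D × Bool) : m.tutteMap.faceDegree x = 4 := by
  have key : ∀ x, Function.IsPeriodicPt m.tutteMap.faceNext 4 x ∧
      ¬ Function.IsPeriodicPt m.tutteMap.faceNext 2 x := by
    rintro ⟨d, _ | _⟩
    · simp [Function.IsPeriodicPt, Function.IsFixedPt, tutteMap_faceNext_false,
        tutteMap_faceNext_true, m.rev_rev]
      intro h
      exact m.rev_ne (m.rot⁻¹ d) (by rw [Perm.eq_inv_iff_eq]; exact h)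
    · simp [Function.IsPeriodicPt, Function.IsFixedPt, tutteMap_faceNext_false,
        tutteMap_faceNext_true, m.rev_rev, m.rev_ne]
  obtain ⟨h4, h2⟩ := key x
  have := Function.IsPeriodicPt.minimalPeriod_dvd h4
  have h2' : ¬ m.tutteMap.faceDegree x ∣ 2 := fun h =>
    h2 ((Function.isPeriodicPt_iff_minimalPeriod_dvd).2 h)
  have hle := Nat.le_of_dvd (by norm_num) this
  unfold faceDegree at *
  interval_cases hh : Function.minimalPeriod m.tutteMap.faceNext x <;> simp_all

theorem sameCycle_le {p : Perm D} (E : Setoid D) (h : ∀ x, E x (p x)) {x y : D}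
    (hxy : p.SameCycle x y) : E x y := by
  have hinv : ∀ x, E x (p⁻¹ x) := fun x => by
    have := h (p⁻¹ x)
    rw [show p (p⁻¹ x) = x from p.apply_symm_apply x] at this
    exact E.symm this
  obtain ⟨i, rfl⟩ := hxy
  induction i with
  | zero => exact E.refl _
  | succ i ih =>
    rw [add_comm, zpow_add, Perm.mul_apply, zpow_one]
    exact E.trans ih (h _)
  | pred i ih =>
    rw [sub_eq_neg_add, zpow_add, Perm.mul_apply, zpow_neg_one]
    exact E.trans ih (hinv _)

theorem setoid_prod_false_iff {p : Perm (D × Bool)} {r : Perm D} {b : Bool}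
    (h : ∀ d, p (d, b) = (r d, b)) (x y : D) :
    p.SameCycle (x, b) (y, b) ↔ r.SameCycle x y := by
  have hinv : ∀ d, p⁻¹ (d, b) = (r⁻¹ d, b) := fun d => by
    rw [Perm.inv_eq_iff_eq, h, show r (r⁻¹ d) = d from r.apply_symm_apply d]
  have key : ∀ i : ℤ, (p ^ i) (x, b) = ((r ^ i) x, b) := by
    intro i
    induction i with
    | zero => rfl
    | succ i ih =>
      rw [add_comm, zpow_add, zpow_add, Perm.mul_apply, Perm.mul_apply, ih, zpow_one, zpow_one, h]
    | pred i ih =>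
      rw [sub_eq_neg_add, zpow_add, zpow_add, Perm.mul_apply, Perm.mul_apply, ih, zpow_neg_one,
        zpow_neg_one, hinv]
  simp only [Perm.SameCycle, key, Prod.mk.injEq, and_true]

theorem not_sameCycle_prod {p : Perm (D × Bool)} (h : ∀ x, (p x).2 = x.2) {x y : D × Bool}
    (hxy : p.SameCycle x y) : x.2 = y.2 :=
  sameCycle_le (Setoid.ker Prod.snd) (fun x => (h x).symm) hxy

theorem card_vertex_tutteMap [Finite D] (m : RootedMap D) :
    Nat.card m.tutteMap.Vertex = Nat.card m.Vertex + Nat.card m.Face := by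
  have hinv : ∀ x y, m.tutteMap.rot.SameCycle (x, true) (y, true) ↔ m.faceNext.SameCycle x y :=
    fun x y => by
      rw [setoid_prod_false_iff (r := m.faceNext⁻¹) (fun _ => rfl), Perm.sameCycle_inv]
  have hrot : ∀ x y, m.tutteMap.rot.SameCycle (x, false) (y, false) ↔ m.rot.SameCycle x y :=
    fun x y => setoid_prod_false_iff (fun _ => rfl) x y
  have : Finite m.Vertex := Quotient.finite _
  have : Finite m.Face := Quotient.finite _
  rw [← Nat.card_sum]
  symm
  refine Nat.card_congr (Equiv.ofBijective (Sum.elim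
    (Quotient.map (fun d => (d, false)) (fun x y h => (hrot x y).2 h))
    (Quotient.map (fun d => (d, true)) (fun x y h => (hinv x y).2 h))) ⟨?_, ?_⟩)
  · rintro (⟨⟨x⟩⟩ | ⟨⟨x⟩⟩) (⟨⟨y⟩⟩ | ⟨⟨y⟩⟩) h
    · exact congrArg Sum.inl (Quotient.sound ((hrot x y).1 (Quotient.exact h)))
    · exact absurd (not_sameCycle_prod (by rintro ⟨d, _ | _⟩ <;> rfl) (Quotient.exact h))
        (by simp)
    · exact absurd (not_sameCycle_prod (by rintro ⟨d, _ | _⟩ <;> rfl) (Quotient.exact h))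
        (by simp)
    · exact congrArg Sum.inr (Quotient.sound ((hinv x y).1 (Quotient.exact h)))
  · rintro ⟨⟨d, _ | _⟩⟩
    · exact ⟨Sum.inl (Quotient.mk _ d), rfl⟩
    · exact ⟨Sum.inr (Quotient.mk _ d), rfl⟩

theorem sameCycle_rev_iff (m : RootedMap D) (x y : D) :
    m.rev.SameCycle x y ↔ y = x ∨ y = m.rev x := by
  constructor
  · rintro ⟨i, rfl⟩
    induction i with
    | zero => simp
    | succ i ih =>
      rw [add_comm, zpow_add, Perm.mul_apply, zpow_one]
      rcases ih with h | h <;> rw [h] <;> simp [m.rev_rev]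
    | pred i ih =>
      rw [sub_eq_neg_add, zpow_add, Perm.mul_apply, zpow_neg_one, rev_inv]
      rcases ih with h | h <;> rw [h] <;> simp [m.rev_rev]
  · rintro (rfl | rfl)
    · exact Perm.SameCycle.refl _ _
    · exact ⟨1, by simp⟩

theorem card_edge_tutteMap (m : RootedMap D) : Nat.card m.tutteMap.Edge = Nat.card D := by
  symm
  refine Nat.card_congr (Equiv.ofBijective (fun d => m.tutteMap.edge (d, false)) ⟨?_, ?_⟩)
  · intro x y h
    have := (m.tutteMap.sameCycle_rev_iff _ _).1 (Quotient.exact h)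
    simpa [eq_comm] using this
  · rintro ⟨⟨d, b⟩⟩
    refine ⟨d, Quotient.sound ((m.tutteMap.sameCycle_rev_iff _ _).2 ?_)⟩
    cases b <;> simp

theorem two_mul_card_edge [Finite D] (m : RootedMap D) : 2 * Nat.card m.Edge = Nat.card D := by
  classical
  have : Fintype D := Fintype.ofFinite _
  have : Finite m.Edge := Quotient.finite _
  have : Fintype m.Edge := Fintype.ofFinite _
  rw [Nat.card_eq_fintype_card, Nat.card_eq_fintype_card, ← Finset.card_univ (α := D),
    Finset.card_eq_sum_card_fiberwise (f := m.edge) (t := Finset.univ) (by simp),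
    Finset.sum_const_nat (m := 2), Finset.card_univ, mul_comm]
  rintro ⟨d⟩ -
  have : (Finset.univ.filter fun x => m.edge x = Quot.mk _ d) = {d, m.rev d} := by
    ext x
    simp only [Finset.mem_filter, Finset.mem_univ, true_and, Finset.mem_insert,
      Finset.mem_singleton]
    rw [← m.sameCycle_rev_iff]
    exact ⟨fun h => (Quotient.exact h : m.rev.SameCycle x d).symm,
      fun h => Quotient.sound (h.symm : m.rev.SameCycle x d)⟩
  rw [this, Finset.card_pair (m.rev_ne d).symm]

theorem card_face_tutteMap (m : RootedMap D) :
    Nat.card m.tutteMap.Face = Nat.card m.Edge := by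
  let f : D × Bool → D := fun x => if x.2 then x.1 else m.rot⁻¹ x.1
  have hstep : ∀ x, m.rev.SameCycle (f x) (f (m.tutteMap.faceNext x)) := by
    rintro ⟨d, _ | _⟩
    · rw [tutteMap_faceNext_false, sameCycle_rev_iff]; simp [f]
    · rw [tutteMap_faceNext_true, sameCycle_rev_iff]; simp [f]
  have hfwd : ∀ x y, m.tutteMap.faceNext.SameCycle x y → m.rev.SameCycle (f x) (f y) := by
    exact fun x y h => sameCycle_le ((Perm.SameCycle.setoid m.rev).comap f) hstep h
  have hto : ∀ x, m.tutteMap.faceNext.SameCycle x (f x, true) := by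
    rintro ⟨d, _ | _⟩
    · refine Perm.SameCycle.symm ⟨1, ?_⟩
      simp [f, tutteMap_faceNext_true]
    · exact Perm.SameCycle.refl _ _
  have hrev : ∀ d, m.tutteMap.faceNext.SameCycle (d, true) (m.rev d, true) := fun d =>
    ⟨2, by
      rw [show (2 : ℤ) = 1 + 1 from rfl, zpow_add]
      simp [tutteMap_faceNext_true, tutteMap_faceNext_false]⟩
  refine card_quotient_congr f (fun x y => ⟨hfwd x y, fun h => ?_⟩) (fun y => ⟨(y, true), ?_⟩)
  · refine (hto x).trans (Perm.SameCycle.trans ?_ (hto y).symm)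
    rcases (m.sameCycle_rev_iff _ _).1 h with h | h <;> rw [h]
    exact hrev _
  · exact Perm.SameCycle.refl _ _

theorem IsPlanarMap.tutteMap [Finite D] {m : RootedMap D} (h : m.IsPlanarMap) :
    m.tutteMap.IsQuadrangulation where
  connected := tutteMap_connected h.connected
  euler := by
    rw [card_vertex_tutteMap, card_face_tutteMap, card_edge_tutteMap, ← two_mul_card_edge m]
    have := h.euler
    omega
  degree := m.tutteMap_faceDegree

theorem IsIso.tutteMap {m : RootedMap D} {m' : RootedMap D'} {g : D ≃ D'} (h : m.IsIso m' g) :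
    m.tutteMap.IsIso m'.tutteMap (g.prodCongr (Equiv.refl Bool)) := by
  obtain rfl := h.eq_relabel
  refine ⟨?_, ?_, rfl⟩
  · rintro ⟨d, _ | _⟩ <;> simp [faceNext_inv_apply]
    · simp [relabel, permCongr_apply]
    · rw [show (Equiv.symm (m.relabel g).rot) (g d) = g (m.rot.symm d) by
        rw [symm_apply_eq]; simp [relabel, permCongr_apply]]
      simp [relabel, permCongr_apply]
  · rintro ⟨d, b⟩; simp

/-! The flip does not depend on the orientation of the edge, and rotations and flips are
compatible with relabelling. -/

section Operations

set_option linter.unusedSectionVars false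

variable [DecidableEq D] [DecidableEq D']

theorem detach_apply_self (σ : Perm D) (a : D) : detach σ a a = a := by
  simp [detach]

theorem detach_apply_of_fixed (σ : Perm D) {a b : D} (h : σ b = b) : detach σ a b = b := by
  by_cases hab : b = a
  · rw [hab, detach_apply_self]
  · have : b ≠ σ.symm a := fun h' => hab (by rw [← h, h', apply_symm_apply])
    simp [detach, swap_apply_of_ne_of_ne this hab, h]

theorem detach_comm (σ : Perm D) {a b : D} (hab : a ≠ b) :
    detach (detach σ a) b = detach (detach σ b) a := by
  ext x
  simp only [detach, mul_inv_rev, Perm.mul_apply, swap_inv, swap_apply_def]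
  have h1 : ∀ y z, σ⁻¹ y = z ↔ y = σ z := fun y z => Perm.inv_eq_iff_eq
  have h2 : ∀ y, σ (σ⁻¹ y) = y := fun y => σ.apply_symm_apply y
  have h3 : ∀ y, σ⁻¹ (σ y) = y := fun y => σ.symm_apply_apply y
  generalize σ⁻¹ = τ at *
  grind

theorem insertBefore_comm (σ : Perm D) {a b z w : D} (ha : σ a = a) (hb : σ b = b) (hab : a ≠ b)
    (hzw : z ≠ w) (hza : z ≠ a) (hzb : z ≠ b) (hwa : w ≠ a) :
    insertBefore (insertBefore σ a z) b w = insertBefore (insertBefore σ b w) a z := by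
  ext x
  simp only [insertBefore, insertAfter, mul_inv_rev, Perm.mul_apply, swap_inv, swap_apply_def]
  have h1 : ∀ y z, σ⁻¹ y = z ↔ y = σ z := fun y z => Perm.inv_eq_iff_eq
  have h2 : ∀ y, σ (σ⁻¹ y) = y := fun y => σ.apply_symm_apply y
  have h3 : ∀ y, σ⁻¹ (σ y) = y := fun y => σ.symm_apply_apply y
  generalize σ⁻¹ = τ at *
  grind

theorem flipTarget_ne {q : RootedMap D} (h : ∀ d, q.faceDegree d = 4) (d : D) (s : Dir) :
    q.flipTarget d s ≠ d := by
  intro h'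
  obtain ⟨k, hk0, hk4, hk⟩ : ∃ k, 0 < k ∧ k < 4 ∧ Function.IsPeriodicPt q.faceNext k d := by
    cases s
    · exact ⟨2, by norm_num, by norm_num, h'⟩
    · exact ⟨3, by norm_num, by norm_num, h'⟩
  have := hk.minimalPeriod_le hk0
  have := h d
  unfold faceDegree at this
  omega

theorem sameCycle_flipTarget (q : RootedMap D) (d : D) (s : Dir) :
    q.faceNext.SameCycle d (q.flipTarget d s) := by
  cases s
  · exact ⟨2, rfl⟩
  · exact ⟨3, rfl⟩

theorem flipRot_rev {q : RootedMap D} (h : ∀ d, q.faceDegree d = 4) (d : D) (s : Dir) :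
    q.flipRot (q.rev d) s = q.flipRot d s := by
  unfold flipRot
  rw [q.rev_rev, Perm.sameCycle_comm]
  by_cases hs : q.faceNext.SameCycle d (q.rev d)
  · simp only [hs, not_true_eq_false, if_false]
    by_cases h1 : q.rot (q.rev d) = q.rev d
    · by_cases h2 : q.rot d = d
      · exfalso
        apply flipTarget_ne h d .plus
        simp [flipTarget, faceNext, h1, q.rev_rev, h2]
      · simp [h1, h2]
    · simp [h1]
  · simp only [hs, not_false_eq_true, if_true]
    have n1 := flipTarget_ne h d s
    have n2 := flipTarget_ne h (q.rev d) s
    have c1 := q.sameCycle_flipTarget d s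
    have c2 := q.sameCycle_flipTarget (q.rev d) s
    rw [detach_comm q.rot (q.rev_ne d), insertBefore_comm]
    · exact detach_apply_of_fixed _ (detach_apply_self _ _)
    · exact detach_apply_self _ _
    · exact (q.rev_ne d).symm
    · intro h'; rw [← h'] at c1; exact hs (c1.trans c2.symm)
    · intro h'; rw [h'] at c2; exact hs c2.symm
    · exact n2
    · exact n1

theorem permCongr_insertAfter (g : D ≃ D') (σ : Perm D) (a x : D) :
    g.permCongr (insertAfter σ a x) = insertAfter (g.permCongr σ) (g a) (g x) := by
  ext y
  obtain ⟨y, rfl⟩ := g.surjective y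
  simp only [insertAfter, permCongr_apply, symm_apply_apply, Perm.mul_apply, swap_apply_def,
    g.injective.eq_iff]
  split_ifs <;> simp

theorem permCongr_inv_apply (g : D ≃ D') (σ : Perm D) (x : D) :
    (g.permCongr σ)⁻¹ (g x) = g (σ⁻¹ x) := by
  rw [Perm.inv_eq_iff_eq, permCongr_apply, symm_apply_apply]
  exact congrArg g (σ.apply_symm_apply x).symm

theorem permCongr_insertBefore (g : D ≃ D') (σ : Perm D) (a z : D) :
    g.permCongr (insertBefore σ a z) = insertBefore (g.permCongr σ) (g a) (g z) := by
  rw [insertBefore, permCongr_insertAfter, insertBefore, permCongr_inv_apply]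

theorem permCongr_detach (g : D ≃ D') (σ : Perm D) (a : D) :
    g.permCongr (detach σ a) = detach (g.permCongr σ) (g a) :=
  permCongr_insertBefore g σ a a

theorem relabel_rot_apply (m : RootedMap D) (g : D ≃ D') (d : D) :
    (m.relabel g).rot (g d) = g (m.rot d) := by simp [relabel, permCongr_apply]

theorem relabel_rot_inv_apply (m : RootedMap D) (g : D ≃ D') (d : D) :
    (m.relabel g).rot⁻¹ (g d) = g (m.rot⁻¹ d) := permCongr_inv_apply _ _ _

theorem relabel_rev_apply (m : RootedMap D) (g : D ≃ D') (d : D) :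
    (m.relabel g).rev (g d) = g (m.rev d) := by simp [relabel, permCongr_apply]

theorem relabel_faceNext_apply (m : RootedMap D) (g : D ≃ D') (d : D) :
    (m.relabel g).faceNext (g d) = g (m.faceNext d) := by
  simp [relabel_faceNext, permCongr_apply]

theorem relabel_rotate (m : RootedMap D) (g : D ≃ D') (c : D) (s : Dir) :
    (m.relabel g).rotate (g c) s = (m.rotate c s).relabel g := by
  have hroot : (m.relabel g).root = g m.root := rfl
  cases s <;> apply ext'
  · simp only [rotate, relabel_rot_inv_apply, relabel_rev_apply]
    simp only [relabel, permCongr_insertBefore, permCongr_detach]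
  · rfl
  · simp only [rotate, relabel_rot_inv_apply, relabel_rev_apply, hroot, g.injective.eq_iff]
    simp only [relabel]; split_ifs <;> rfl
  · simp only [rotate, relabel_rot_inv_apply, relabel_rev_apply]
    simp only [relabel, permCongr_insertAfter, permCongr_detach]
  · rfl
  · simp only [rotate, relabel_rot_inv_apply, hroot, g.injective.eq_iff]
    simp only [relabel]; split_ifs <;> rfl

theorem relabel_flipTarget (q : RootedMap D) (g : D ≃ D') (d : D) (s : Dir) :
    (q.relabel g).flipTarget (g d) s = g (q.flipTarget d s) := by
  cases s <;> simp only [flipTarget, relabel_faceNext_apply]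

theorem relabel_flipDart (q : RootedMap D) (g : D ≃ D') (d : D) (s : Dir) :
    (q.relabel g).flipDart (g d) s = (q.flipDart d s).relabel g := by
  apply ext'
  · change (q.relabel g).flipRot (g d) s = g.permCongr (q.flipRot d s)
    have hrot : (q.relabel g).rot = g.permCongr q.rot := rfl
    have hs : (q.relabel g).faceNext.SameCycle (g d) ((q.relabel g).rev (g d)) ↔
        q.faceNext.SameCycle d (q.rev d) := by
      rw [relabel_rev_apply, relabel_faceNext, sameCycle_permCongr]
    unfold flipRot
    by_cases h : q.faceNext.SameCycle d (q.rev d)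
    · rw [if_neg (not_not.2 (hs.2 h)), if_neg (not_not.2 h)]
      simp only [relabel_rev_apply, relabel_rot_apply, relabel_faceNext_apply,
        g.injective.eq_iff]
      simp only [hrot]
      split_ifs <;> first | rfl | simp only [permCongr_insertBefore, permCongr_detach]
    · rw [if_pos (mt hs.1 h), if_pos h]
      simp only [relabel_rev_apply, relabel_flipTarget, hrot, permCongr_insertBefore,
        permCongr_detach]
  · rfl
  · rfl

/-- The flip `q^{e,s}` of the edge `e` of the quadrangulation `q`. -/
noncomputable def flip (q : RootedMap D) (hq : q.IsQuadrangulation) (e : q.Edge) (s : Dir) :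
    RootedMap D :=
  Quotient.lift (fun d => q.flipDart d s) (by
    intro a b h
    rcases (q.sameCycle_rev_iff a b).1 h with rfl | rfl
    · rfl
    · simp only [flipDart, flipRot_rev hq.degree]) e

theorem IsIso.rotate {m : RootedMap D} {m' : RootedMap D'} {g : D ≃ D'} (h : m.IsIso m' g)
    (c : D) (s : Dir) : (m.rotate c s).Iso (m'.rotate (g c) s) := by
  obtain rfl := h.eq_relabel
  rw [relabel_rotate]
  exact ⟨g, isIso_relabel _ _⟩

theorem IsIso.flip {q : RootedMap D} {q' : RootedMap D'} {g : D ≃ D'} (h : q.IsIso q' g)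
    (hq : q.IsQuadrangulation) (hq' : q'.IsQuadrangulation) (d : D) (s : Dir) :
    (q.flip hq (q.edge d) s).Iso (q'.flip hq' (q'.edge (g d)) s) := by
  obtain rfl := h.eq_relabel
  change (q.flipDart d s).Iso ((q.relabel g).flipDart (g d) s)
  rw [relabel_flipDart]
  exact ⟨g, isIso_relabel _ _⟩

end Operations

/-- The correspondence between edges induced by an isomorphism. -/
def IsIso.edgeEquiv {m : RootedMap D} {m' : RootedMap D'} {g : D ≃ D'} (h : m.IsIso m' g) :
    m.Edge ≃ m'.Edge :=
  Quotient.congr g (fun x y => by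
    change m.rev.SameCycle x y ↔ m'.rev.SameCycle (g x) (g y)
    rw [sameCycle_rev_iff, sameCycle_rev_iff, ← h.rev, g.injective.eq_iff, g.injective.eq_iff])

@[simp] theorem IsIso.edgeEquiv_edge {m : RootedMap D} {m' : RootedMap D'} {g : D ≃ D'}
    (h : m.IsIso m' g) (d : D) : h.edgeEquiv (m.edge d) = m'.edge (g d) := rfl

noncomputable instance [Finite D] (m : RootedMap D) : Fintype m.Edge :=
  @Fintype.ofFinite _ (Quotient.finite _)

instance [Finite D] : Finite (RootedMap D) :=
  Finite.of_injective (fun m : RootedMap D => (m.rot, m.rev, m.root)) (fun m m' h => by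
    simp only [Prod.mk.injEq] at h
    exact ext' h.1 h.2.1 h.2.2)

end RootedMap

/-! ### Rooted planar maps with `n` edges and rooted quadrangulations with `n` faces -/

open RootedMap

/-- Rooted planar maps with `n` edges, with labelled darts. -/
abbrev LabelledMap (n : ℕ) : Type := {m : RootedMap (Fin (2 * n)) // m.IsPlanarMap}

/-- Rooted quadrangulations with `n` faces (hence `2 n` edges), with labelled darts. -/
abbrev LabelledQuad (n : ℕ) : Type := {q : RootedMap (Fin (4 * n)) // q.IsQuadrangulation}

instance mapSetoid (n : ℕ) : Setoid (LabelledMap n) where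
  r m m' := m.1.Iso m'.1
  iseqv := ⟨fun m => Iso.refl m.1, Iso.symm, Iso.trans⟩

instance quadSetoid (n : ℕ) : Setoid (LabelledQuad n) where
  r q q' := q.1.Iso q'.1
  iseqv := ⟨fun q => Iso.refl q.1, Iso.symm, Iso.trans⟩

/-- The set of rooted planar maps with `n` edges. -/
def PlanarMap (n : ℕ) : Type := Quotient (mapSetoid n)

/-- The set of rooted quadrangulations with `n` faces. -/
def Quadrangulation (n : ℕ) : Type := Quotient (quadSetoid n)

def LabelledMap.toMap {n : ℕ} (m : LabelledMap n) : PlanarMap n := Quotient.mk _ m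
def LabelledQuad.toQuad {n : ℕ} (q : LabelledQuad n) : Quadrangulation n := Quotient.mk _ q

noncomputable instance (n : ℕ) : Fintype (PlanarMap n) :=
  @Fintype.ofFinite _ (Quotient.finite _)

noncomputable instance (n : ℕ) : Fintype (Quadrangulation n) :=
  @Fintype.ofFinite _ (Quotient.finite _)

open Classical in
noncomputable instance (n : ℕ) : DecidableEq (PlanarMap n) := inferInstance

open Classical in
noncomputable instance (n : ℕ) : DecidableEq (Quadrangulation n) := inferInstance

/-- A numbering of the `4 n` darts of the quadrangulation associated with a map with `2 n` darts. -/
def dartEquiv (n : ℕ) : Fin (2 * n) × Bool ≃ Fin (4 * n) :=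
  ((Equiv.refl _).prodCongr finTwoEquiv.symm).trans
    (finProdFinEquiv.trans (finCongr (by omega)))

/-- Tutte's mapping, from rooted planar maps with `n` edges to rooted quadrangulations with
`n` faces. -/
def tutte (n : ℕ) : PlanarMap n → Quadrangulation n :=
  Quotient.map (fun m => ⟨m.1.tutteMap.relabel (dartEquiv n), m.2.tutteMap.relabel _⟩)
    (fun _ _ h => (Iso.symm ⟨_, isIso_relabel _ _⟩).trans
      (Iso.trans ⟨_, h.choose_spec.tutteMap⟩ ⟨_, isIso_relabel _ _⟩))

/-! ### The two Markov chains -/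

open Classical in
/-- The indicator of a proposition. -/
noncomputable def ind (P : Prop) : ℝ := if P then 1 else 0

/-- The transition probability of the edge rotation chain from `m` to `m'`. -/
noncomputable def rotationProb {n : ℕ} (m m' : LabelledMap n) : ℝ :=
  1 / (3 * (2 * (n : ℝ) - 1)) * ∑ c with c ≠ m.1.root,
    (ind (m'.1.Iso (m.1.rotate c .plus)) + ind (m'.1.Iso (m.1.rotate c .minus)) +
      ind (m'.1.Iso m.1))

open Classical in
/-- The transition probability of the non-root edge flip chain from `q` to `q'`. -/
noncomputable def flipProb {n : ℕ} (q q' : LabelledQuad n) : ℝ :=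
  1 / (3 * (2 * (n : ℝ) - 1)) * ∑ e with e ≠ q.1.rootEdge,
    (ind (q'.1.Iso (q.1.flip q.2 e .plus)) + ind (q'.1.Iso (q.1.flip q.2 e .minus)) +
      ind (q'.1.Iso q.1))

theorem ind_iso_congr {D₁ D₂ D₃ D₄ : Type*} {a : RootedMap D₁} {b : RootedMap D₂}
    {c : RootedMap D₃} {d : RootedMap D₄} (h : a.Iso b) (h' : c.Iso d) :
    ind (a.Iso c) = ind (b.Iso d) :=
  congrArg ind (propext ⟨fun H => (h.symm.trans H).trans h', fun H => (h.trans H).trans h'.symm⟩)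

theorem rotationProb_congr {n : ℕ} (m₁ m₁' m₂ m₂' : LabelledMap n) (h : m₁ ≈ m₂)
    (h' : m₁' ≈ m₂') : rotationProb m₁ m₁' = rotationProb m₂ m₂' := by
  obtain ⟨g, hg⟩ := h
  unfold rotationProb
  congr 1
  refine Finset.sum_equiv g ?_ ?_
  · intro c
    simp [← hg.root]
  · intro c _
    rw [ind_iso_congr h' (hg.rotate c .plus), ind_iso_congr h' (hg.rotate c .minus),
      ind_iso_congr h' ⟨g, hg⟩]

theorem flipProb_congr {n : ℕ} (q₁ q₁' q₂ q₂' : LabelledQuad n) (h : q₁ ≈ q₂)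
    (h' : q₁' ≈ q₂') : flipProb q₁ q₁' = flipProb q₂ q₂' := by
  obtain ⟨g, hg⟩ := h
  unfold flipProb
  congr 1
  refine Finset.sum_equiv hg.edgeEquiv ?_ ?_
  · intro e
    have : q₂.1.rootEdge = hg.edgeEquiv q₁.1.rootEdge := by
      simp [rootEdge, hg.root]
    simp [this]
  · rintro ⟨d⟩ _
    have key : ∀ s, (q₁.1.flip q₁.2 (q₁.1.edge d) s).Iso
        (q₂.1.flip q₂.2 (hg.edgeEquiv (q₁.1.edge d)) s) := fun s => hg.flip q₁.2 q₂.2 d s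
    change ind (q₁'.1.Iso (q₁.1.flip q₁.2 (q₁.1.edge d) .plus)) +
      ind (q₁'.1.Iso (q₁.1.flip q₁.2 (q₁.1.edge d) .minus)) + _ =
      ind (q₂'.1.Iso (q₂.1.flip q₂.2 (hg.edgeEquiv (q₁.1.edge d)) .plus)) +
      ind (q₂'.1.Iso (q₂.1.flip q₂.2 (hg.edgeEquiv (q₁.1.edge d)) .minus)) + _
    rw [ind_iso_congr h' (key .plus), ind_iso_congr h' (key .minus), ind_iso_congr h' ⟨g, hg⟩]

/-- The transition matrix of the edge rotation chain on rooted planar maps with `n` edges. -/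
noncomputable def rotationMatrix (n : ℕ) : Matrix (PlanarMap n) (PlanarMap n) ℝ :=
  Matrix.of (Quotient.lift₂ rotationProb rotationProb_congr)

/-- The transition matrix of the (non-root) edge flip chain on rooted quadrangulations with
`n` faces. -/
noncomputable def flipMatrix (n : ℕ) : Matrix (Quadrangulation n) (Quadrangulation n) ℝ :=
  Matrix.of (Quotient.lift₂ flipProb flipProb_congr)

end MapChains

open MapChains

namespace MapChains.RootedMap

open Equiv

/-! ### Cycles of a permutation after moving one element -/

section Detach

variable {D : Type*} [DecidableEq D]

/-! Tutte's construction turns the edges of a map `m` into the faces of a quadrangulation, each edge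
being a diagonal of its face, and the corners of `m` into edges. The edge issued from a corner `c`
separates the two faces whose diagonals are `e₋` and `e₊`. Flipping it merges these faces and splits
their hexagon again, so that two sides `e₋`, `e₊` of the triangle at `c` become `e₌` and one of
them: this is the rotation of `m` at `c`. The two faces coincide exactly when `e₋ = e₊`, that is,
when the vertex or the face of `c` has degree 1; these cases give the degenerate flip. On darts, the
identity is an explicit relabelling, `rotateEquiv`, checked separately for a vertex of degree 1, a
face of degree 1 and the generic corner (`flipDart_tutteMap_iso`).

Rotations preserve planarity because both the vertex permutation and the face permutation change by
moving a single dart; a vertex of degree 1 is lost exactly when a face of degree 1 is gained, and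
conversely, so Euler's formula survives. That a flip gives a quadrangulation is then deduced from
the isomorphism with the Tutte quadrangulation of the rotated map.

Tutte's mapping is injective because rooted isomorphisms preserve the two colours (old and new
vertices), and `rot` and `faceNext` determine `rev`. It is surjective because a planar
quadrangulation is bipartite, and the diagonals joining the vertices of the root colour form the
required map. Bipartiteness is the vanishing of planar homology mod 2: by Euler's formula, the cuts
of the graph fill the orthogonal complement of the cuts of its dual, and the constant function 1 on
the edges lies in this complement as all faces have even degree.

Both chains then sum corresponding terms over corresponding index sets, so stochasticity of one
matrix gives that of the other. -/

theorem detach_apply (σ : Perm D) (d x : D) :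
    detach σ d x = if x = d then d else if σ x = d then σ d else σ x := by
  have h1 : x = σ⁻¹ d ↔ σ x = d := Perm.eq_inv_iff_eq
  have h2 : σ (σ⁻¹ d) = d := σ.apply_symm_apply d
  simp only [detach, Perm.mul_apply, swap_apply_def]
  grind

theorem detach_of_fixed {σ : Perm D} {d : D} (h : σ d = d) : detach σ d = σ := by
  ext x
  rw [detach_apply]
  grind [σ.injective.eq_iff]

theorem SameCycle.of_detach {σ : Perm D} {d x y : D} (h : (detach σ d).SameCycle x y) :
    σ.SameCycle x y := by
  refine sameCycle_le (Perm.SameCycle.setoid σ) (fun x => ?_) h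
  change σ.SameCycle x _
  rw [detach_apply]
  split_ifs with h1 h2
  · rw [h1]
  · exact ⟨2, by rw [show (2 : ℤ) = 1 + 1 from rfl, zpow_add]; simp [h2]⟩
  · exact ⟨1, by simp⟩

/-- Replace `d` by its successor. -/
def skip (σ : Perm D) (d x : D) : D := if x = d then σ d else x

/-- `detach σ d` follows the cycles of `σ` and jumps over `d`, so a walk along a cycle of `σ`
remains a walk once `d` is replaced by its successor. -/
theorem SameCycle.detach_skip {σ : Perm D} {d x y : D} (h : σ.SameCycle x y) :
    (detach σ d).SameCycle (skip σ d x) (skip σ d y) := by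
  refine sameCycle_le ((Perm.SameCycle.setoid (detach σ d)).comap (skip σ d)) (fun x => ?_) h
  change (detach σ d).SameCycle (skip σ d x) (skip σ d (σ x))
  by_cases h1 : x = d
  · subst h1
    simp only [skip, if_true]
    split_ifs with h2 <;> simp [Perm.SameCycle.refl]
  · have h2 : detach σ d x = skip σ d (σ x) := by
      rw [detach_apply, if_neg h1]; rfl
    rw [← h2, skip, if_neg h1]
    exact ⟨1, by simp⟩

theorem sameCycle_skip (σ : Perm D) (d x : D) : σ.SameCycle x (skip σ d x) := by
  unfold skip
  split_ifs with h
  · rw [h]; exact ⟨1, by simp⟩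
  · exact Perm.SameCycle.refl _ _

theorem sameCycle_detach_self {σ : Perm D} {d x : D} (h : (detach σ d).SameCycle d x) :
    x = d := by
  have : Function.IsFixedPt (detach σ d) d := detach_apply_self σ d
  exact (h.eq_of_left this).symm

/-- The number of cycles, including the fixed points. -/
noncomputable def numCycles (σ : Perm D) : ℕ := Nat.card (Quotient (Perm.SameCycle.setoid σ))

/-- If `d` is not fixed, its old cycle survives without it and `{d}` is a new cycle; in the
bijection below `none` stands for `{d}`. Applied before and after a move of `d`, this compares the
numbers of cycles. -/
theorem numCycles_detach [Finite D] (σ : Perm D) (d : D) :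
    numCycles (detach σ d) = numCycles σ + if σ d = d then 0 else 1 := by
  split_ifs with hd
  · rw [detach_of_fixed hd, add_zero]
  have : Finite (Quotient (Perm.SameCycle.setoid σ)) := Quotient.finite _
  have hne : ∀ x, skip σ d x ≠ d := fun x => by unfold skip; split_ifs with h <;> assumption
  unfold numCycles
  rw [← Finite.card_option]
  symm
  refine Nat.card_congr (Equiv.ofBijective (fun o : Option (Quotient (Perm.SameCycle.setoid σ)) =>
    o.elim (Quotient.mk (Perm.SameCycle.setoid (detach σ d)) d)
      (Quotient.map (skip σ d) (fun x y h => SameCycle.detach_skip h))) ⟨?_, ?_⟩)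
  · rintro (_ | ⟨⟨x⟩⟩) (_ | ⟨⟨y⟩⟩) h
    · rfl
    · exact absurd (sameCycle_detach_self (Quotient.exact h)) (hne y)
    · exact absurd (sameCycle_detach_self (Quotient.exact h.symm)) (hne x)
    · refine congrArg some (Quotient.sound ?_)
      have h' : (detach σ d).SameCycle (skip σ d x) (skip σ d y) := Quotient.exact h
      exact ((sameCycle_skip σ d x).trans (SameCycle.of_detach h')).trans
        (sameCycle_skip σ d y).symm
  · rintro ⟨x⟩
    by_cases hx : x = d
    · exact ⟨none, by rw [hx]; rfl⟩
    · refine ⟨some (Quotient.mk _ x), ?_⟩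
      change Quotient.mk _ (skip σ d x) = _
      rw [skip, if_neg hx]; rfl

end Detach

/-! ### Connectedness -/

section Connected

variable {D : Type*}

theorem IsConnected.rel {m : RootedMap D} (h : m.IsConnected) (E : Setoid D)
    (hrot : ∀ x, E x (m.rot x)) (hrev : ∀ x, E x (m.rev x)) (x y : D) : E x y := by
  induction h x y with
  | refl => exact E.refl _
  | tail _ hs ih =>
    rcases hs with rfl | rfl
    · exact E.trans ih (hrot _)
    · exact E.trans ih (hrev _)

/-- Reachability is already symmetric, since on a finite set the inverse of `rot` is a power of
`rot`. This form lets connectedness be transferred between maps on the same darts. -/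
theorem isConnected_iff [Finite D] (m : RootedMap D) :
    m.IsConnected ↔ ∀ E : Setoid D, (∀ x, E x (m.rot x)) → (∀ x, E x (m.rev x)) →
      ∀ x y, E x y := by
  refine ⟨fun h E h1 h2 => h.rel E h1 h2, fun h => ?_⟩
  set R : D → D → Prop := fun a b => b = m.rot a ∨ b = m.rev a with hR
  have hpow : ∀ (k : ℕ) x, Relation.ReflTransGen R x ((m.rot ^ k) x) := by
    intro k x
    induction k with
    | zero => exact .refl
    | succ k ih => rw [pow_succ']; exact ih.tail (Or.inl rfl)
  have hback : ∀ a b, R a b → Relation.ReflTransGen R b a := by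
    rintro a b (rfl | rfl)
    · have : (m.rot ^ (orderOf m.rot - 1)) (m.rot a) = a := by
        rw [← Perm.mul_apply, ← pow_succ, Nat.sub_add_cancel (orderOf_pos _), pow_orderOf_eq_one]
        rfl
      have h2 := hpow (orderOf m.rot - 1) (m.rot a)
      rwa [this] at h2
    · exact .single (Or.inr (m.rev_rev a).symm)
  refine h ⟨Relation.ReflTransGen R, fun _ => .refl, fun {x y} hxy => ?_, .trans⟩
    (fun x => .single (Or.inl rfl)) (fun x => .single (Or.inr rfl))
  induction hxy with
  | refl => exact .refl
  | tail _ hs ih => exact (hback _ _ hs).trans ih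

/-- With `V`, `E`, `F` counted in `m`, Euler's formula for the quadrangulation reads `(V + F) + E =
2E + 2`, which is Euler's formula for `m`. -/
theorem isPlanarMap_of_tutteMap [Finite D] {m : RootedMap D} (h : m.tutteMap.IsPlanarMap) :
    m.IsPlanarMap where
  connected := by
    refine (isConnected_iff m).2 fun E hrot hrev x y => ?_
    refine h.connected.rel (E.comap Prod.fst) ?_ ?_ (x, false) (y, false)
    · rintro ⟨d, _ | _⟩
      · exact hrot d
      · change E d (m.faceNext⁻¹ d)
        rw [faceNext_inv_apply]
        refine E.trans ?_ (hrev _)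
        have := hrot (m.rot⁻¹ d)
        rw [show m.rot (m.rot⁻¹ d) = d from m.rot.apply_symm_apply d] at this
        exact E.symm this
    · rintro ⟨d, b⟩
      exact E.refl _
  euler := by
    have := h.euler
    rw [card_vertex_tutteMap, card_face_tutteMap, card_edge_tutteMap, ← two_mul_card_edge m]
      at this
    omega

end Connected

theorem faceNext_apply {D : Type*} (m : RootedMap D) (d : D) :
    m.faceNext d = m.rot (m.rev d) := rfl

/-! ### Rotations preserve planarity -/

section Rotate

variable {D : Type*} [DecidableEq D]

theorem rotate_rev (m : RootedMap D) (c : D) (s : Dir) : (m.rotate c s).rev = m.rev := by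
  cases s <;> rfl

theorem detach_insertAfter {σ : Perm D} {d : D} (h : σ d = d) (x : D) :
    detach (insertAfter σ d x) d = σ := by
  ext y
  simp only [detach_apply, insertAfter, Perm.mul_apply, swap_apply_def]
  grind [σ.injective.eq_iff]

/-- The two maps differ only in the position of `x` around the vertices. An equivalence relation
stable under `m'` therefore contains the cycles of `m.rot` with `x` removed, and it only remains to
link `x` with one of its old neighbours, which is `hE`. -/
theorem isConnected_of_detach [Finite D] {m m' : RootedMap D} (h : m.IsConnected)
    (hrev : m'.rev = m.rev) {x : D} (hx : detach m'.rot x = detach m.rot x)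
    (hE : ∀ E : Setoid D, (∀ y, E y (m'.rot y)) → (∀ y, E y (m'.rev y)) →
      E x (m.rot x) ∨ E x (m.rot⁻¹ x)) :
    m'.IsConnected := by
  refine (isConnected_iff m').2 fun E h1 h2 => ?_
  have hτ : ∀ {y z}, (detach m.rot x).SameCycle y z → E y z := fun hyz => by
    rw [← hx] at hyz
    exact sameCycle_le E h1 (SameCycle.of_detach hyz)
  have hs : ∀ y z, m.rot.SameCycle y z → E (skip m.rot x y) (skip m.rot x z) :=
    fun y z h => hτ (SameCycle.detach_skip h)
  have hsx : E x (m.rot x) := by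
    refine (hE E h1 h2).elim id fun h => ?_
    by_cases hfix : m.rot x = x
    · rw [hfix]
    · have := hs x (m.rot⁻¹ x) ⟨-1, by simp⟩
      have h3 : m.rot⁻¹ x ≠ x := fun h' => hfix (by
        conv_lhs => rw [← h']
        exact m.rot.apply_symm_apply x)
      rw [skip, if_pos rfl, skip, if_neg h3] at this
      exact E.trans h (E.symm this)
  have hsk : ∀ y, E y (skip m.rot x y) := fun y => by
    unfold skip
    split_ifs with h
    · rwa [h]
    · exact E.refl _
  refine h.rel E (fun y => ?_) (fun y => by rw [← hrev]; exact h2 y)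
  exact E.trans (E.trans (hsk y) (hs y _ ⟨1, by simp⟩)) (E.symm (hsk _))

theorem insertAfter_apply {σ : Perm D} {d : D} (h : σ d = d) (x y : D) :
    insertAfter σ d x y = if y = d then σ x else if y = x then d else σ y := by
  simp only [insertAfter, Perm.mul_apply, swap_apply_def]
  grind

theorem insertBefore_apply {σ : Perm D} {d : D} (h : σ d = d) (z y : D) :
    insertBefore σ d z y = if y = d then z else if σ y = z then d else σ y := by
  have h1 : y = σ⁻¹ z ↔ σ y = z := Perm.eq_inv_iff_eq
  have h2 : σ (σ⁻¹ z) = z := σ.apply_symm_apply z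
  rw [insertBefore, insertAfter_apply h]
  grind

theorem rotate_plus_rot_apply (m : RootedMap D) (c x : D) :
    (m.rotate c .plus).rot x = if x = c then m.rev (m.rot⁻¹ c) else
      if detach m.rot c x = m.rev (m.rot⁻¹ c) then c else detach m.rot c x :=
  insertBefore_apply (detach_apply_self _ _) _ _

theorem rotate_minus_rot_apply (m : RootedMap D) (c x : D) :
    (m.rotate c .minus).rot x =
      if x = m.rot⁻¹ c then detach m.rot (m.rot⁻¹ c) (m.rev c) else
        if x = m.rev c then m.rot⁻¹ c else detach m.rot (m.rot⁻¹ c) x :=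
  insertAfter_apply (detach_apply_self _ _) _ _

/-- The dart that a rotation detaches from its vertex. -/
def movedDart (m : RootedMap D) (c : D) : Dir → D
  | .plus => c
  | .minus => m.rot⁻¹ c

/-- The dart that a rotation moves to another face contour. -/
def movedCorner (m : RootedMap D) (c : D) : Dir → D
  | .plus => m.rev (m.rot⁻¹ c)
  | .minus => c

theorem detach_rotate_rot (m : RootedMap D) (c : D) (s : Dir) :
    detach (m.rotate c s).rot (m.movedDart c s) = detach m.rot (m.movedDart c s) := by
  cases s
  · ext x
    have := detach_apply_self m.rot c
    rw [movedDart, detach_apply]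
    simp only [rotate_plus_rot_apply]
    grind [Equiv.injective]
  · exact detach_insertAfter (detach_apply_self _ _) _

/-- Dual to `detach_rotate_rot`: in the face contours, too, the rotation moves a single dart, from
the face of `c` to the face across the erased edge. -/
theorem detach_rotate_faceNext (m : RootedMap D) (c : D) (s : Dir) :
    detach (m.rotate c s).faceNext (m.movedCorner c s) =
      detach m.faceNext (m.movedCorner c s) := by
  obtain ⟨a, rfl⟩ := m.rot.surjective c
  have h1 := m.rev_rev
  have h2 := m.rev_ne
  have h3 : m.rot⁻¹ (m.rot a) = a := m.rot.symm_apply_apply a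
  have h4 : ∀ x y, m.rot x = m.rot y ↔ x = y := fun x y => m.rot.injective.eq_iff
  cases s
  · ext x
    simp only [movedCorner, detach_apply, faceNext_apply, rotate_rev, rotate_plus_rot_apply, h3]
    grind
  · ext x
    simp only [movedCorner, detach_apply, faceNext_apply, rotate_rev, rotate_minus_rot_apply, h3]
    grind

theorem IsPlanarMap.rotate [Finite D] {m : RootedMap D} (h : m.IsPlanarMap) (c : D) (s : Dir) :
    (m.rotate c s).IsPlanarMap := by
  have hV := numCycles_detach (m.rotate c s).rot (m.movedDart c s)
  have hF := numCycles_detach (m.rotate c s).faceNext (m.movedCorner c s)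
  rw [detach_rotate_rot, numCycles_detach] at hV
  rw [detach_rotate_faceNext, numCycles_detach] at hF
  have e := h.euler
  have hE : Nat.card (m.rotate c s).Edge = Nat.card m.Edge := by
    have h1 := two_mul_card_edge m
    have h2 := two_mul_card_edge (m.rotate c s)
    omega
  have hV0 : ∀ m : RootedMap D, Nat.card m.Vertex = numCycles m.rot := fun _ => rfl
  have hF0 : ∀ m : RootedMap D, Nat.card m.Face = numCycles m.faceNext := fun _ => rfl
  -- With `c = rot a`, the edges `e₋` and `e₊` are those of the darts `a` and `c`, and inverses of
  -- `rot` disappear.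
  obtain ⟨a, rfl⟩ := m.rot.surjective c
  have h1 := m.rev_rev
  have h2 := m.rev_ne
  have h3 : m.rot⁻¹ (m.rot a) = a := m.rot.symm_apply_apply a
  have h4 : ∀ x y, m.rot x = m.rot y ↔ x = y := fun x y => m.rot.injective.eq_iff
  refine ⟨isConnected_of_detach h.connected (rotate_rev m _ s) (detach_rotate_rot m _ s) ?_, ?_⟩
  · intro E hr hv
    rw [rotate_rev] at hv
    cases s
    · right
      have := hr (m.rot a)
      rw [rotate_plus_rot_apply, if_pos rfl, h3] at this
      change E (m.rot a) (m.rot⁻¹ (m.rot a))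
      rw [h3]
      exact E.trans this (E.symm (hv a))
    · left
      change E (m.rot⁻¹ (m.rot a)) (m.rot (m.rot⁻¹ (m.rot a)))
      rw [h3]
      have := hr (m.rev (m.rot a))
      rw [rotate_minus_rot_apply, h3, if_pos rfl] at this
      split_ifs at this with h5
      · have h6 := hv (m.rot a)
        rw [h5] at h6
        exact E.symm h6
      · exact E.symm (E.trans (hv _) this)
  -- The moved dart was alone at its vertex iff the moved corner is now alone in its face (`a = c`),
  -- and it is now alone at its vertex iff the moved corner was alone in its face (`c = rev a`). So
  -- the corrections in `hV` and `hF` cancel in the sum.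
  · rw [hV0, hF0] at e ⊢
    rw [hE]
    cases s
    · simp only [movedDart, movedCorner, faceNext_apply, rotate_rev, rotate_plus_rot_apply, h3,
        detach_apply] at hV hF
      grind
    · simp only [movedDart, movedCorner, faceNext_apply, rotate_rev, rotate_minus_rot_apply, h3,
        detach_apply] at hV hF
      grind

end Rotate
/-! ### Flips of Tutte's quadrangulation are rotations -/

section Flip

variable {D : Type*} [DecidableEq D]

/-- The correspondence between the darts of the flipped quadrangulation and the darts of the
quadrangulation associated with the rotated map.  The edge of the corner `c` is flipped, and `k`
tells whether its orientation has to be reversed. -/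
def rotateEquiv (c z : D) (k : Bool) : D × Bool ≃ D × Bool where
  toFun x := if x.1 = c then (z, x.2 ^^ k) else if x.1 = z then (c, x.2) else x
  invFun x := if x.1 = z then (c, x.2 ^^ k) else if x.1 = c then (z, x.2) else x
  left_inv := by
    rintro ⟨d, b⟩
    dsimp only
    split_ifs <;> simp_all
  right_inv := by
    rintro ⟨d, b⟩
    dsimp only
    split_ifs <;> simp_all

/-- The exchange of `c` and `z` is forced by naming corners after darts. For `+`, with `z = c₋`, the
moved dart `c` now names the part of `c₋` outside the triangle, so that `z` is left to name the new
corner; for `-`, `z = rot⁻¹ c` is the moved dart and `c` names the merged corner. The flag `k` is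
`true` when the ends of the flipped edge exchange colours. -/
theorem rotateEquiv_apply (c z d : D) (k b : Bool) :
    rotateEquiv c z k (d, b) =
      if d = c then (z, b ^^ k) else if d = z then (c, b) else (d, b) := rfl

/-- Free of inverses, so that the case analyses below reduce to equalities between words in `rot`
and `rev`. -/
theorem eq_tutteMap_rot_iff {D : Type*} (m : RootedMap D) (x y : D × Bool) :
    y = m.tutteMap.rot x ↔
      y.2 = x.2 ∧ if x.2 = true then m.rot (m.rev y.1) = x.1 else y.1 = m.rot x.1 := by
  obtain ⟨d, _ | _⟩ := x <;> obtain ⟨e, b⟩ := y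
  · simp [and_comm]
  · rw [tutteMap_rot_true, Prod.mk.injEq, Perm.eq_inv_iff_eq, and_comm]
    simp [faceNext_apply]

theorem isIso_rotateEquiv {m : RootedMap D} {q : RootedMap (D × Bool)} {m' : RootedMap D}
    (c z : D) (k : Bool) (hrev : q.rev = m.tutteMap.rev)
    (hroot : rotateEquiv c z k q.root = (m'.root, false))
    (hrot : ∀ x, rotateEquiv c z k (q.rot x) = m'.tutteMap.rot (rotateEquiv c z k x)) :
    q.IsIso m'.tutteMap (rotateEquiv c z k) where
  rot := hrot
  rev := by
    rintro ⟨d, b⟩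
    rw [hrev, tutteMap_rev, rotateEquiv_apply, rotateEquiv_apply]
    split_ifs <;> simp
  root := hroot

/-- The function `f` sends a dart of the quadrangulation to a dart of the edge of `m` drawn in its
face. The two sides of the edge issued from `rot a` thus lie in the faces of `a` and of `rot a`,
which coincide iff these darts have the same edge. -/
theorem sameCycle_tutteMap_faceNext_iff {D : Type*} (m : RootedMap D) (a : D) :
    m.tutteMap.faceNext.SameCycle (m.rot a, false) (m.rot a, true) ↔
      m.rot a = a ∨ m.rot a = m.rev a := by
  let f : D × Bool → D := fun x => if x.2 then x.1 else m.rot⁻¹ x.1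
  have hstep : ∀ x, m.rev.SameCycle (f x) (f (m.tutteMap.faceNext x)) := by
    rintro ⟨d, _ | _⟩
    · rw [tutteMap_faceNext_false, sameCycle_rev_iff]; simp [f]
    · rw [tutteMap_faceNext_true, sameCycle_rev_iff]; simp [f]
  constructor
  · intro h
    have := sameCycle_le ((Perm.SameCycle.setoid m.rev).comap f) hstep h
    have := (m.sameCycle_rev_iff _ _).1 this
    simpa [f] using this
  · rintro (h | h)
    · refine ⟨3, ?_⟩
      rw [show (3 : ℤ) = 1 + 1 + 1 from rfl, zpow_add, zpow_add]
      have h' : m.rot.symm a = a := by rw [symm_apply_eq, h]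
      simp [tutteMap_faceNext_true, tutteMap_faceNext_false, m.rev_rev, h, h']
    · refine ⟨1, ?_⟩
      have h' : m.rot.symm (m.rev a) = a := by rw [symm_apply_eq, h]
      simp [tutteMap_faceNext_false, h, h']

theorem tutteMap_rot_apply {D : Type*} (m : RootedMap D) (d : D) (b : Bool) :
    m.tutteMap.rot (m.rot d, b) =
      if b = true then (m.rev d, true) else (m.rot (m.rot d), false) := by
  cases b
  · simp
  · simp [faceNext_inv_apply]

/-- The vertex of `c` has degree 1. It is kept by the flip but becomes the new vertex drawn inside
the loop created by the rotation: the colours are exchanged, hence `true`. For `-`, the relabelling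
only reverses the edge of `c`. -/
theorem flipRot_tutteMap_of_rot_eq_self (m : RootedMap D) {c : D} (h : m.rot c = c) (s : Dir)
    (x : D × Bool) :
    rotateEquiv c (match s with | .plus => m.rev c | .minus => c) true
        (m.tutteMap.flipRot (c, false) s x) =
      (m.rotate c s).tutteMap.rot
        (rotateEquiv c (match s with | .plus => m.rev c | .minus => c) true x) := by
  have h1 := m.rev_rev
  have h2 := m.rev_ne
  have h3 : m.rot⁻¹ c = c := by rw [Perm.inv_eq_iff_eq, h]
  have h4 : ∀ x y, m.rot x = m.rot y ↔ x = y := fun x y => m.rot.injective.eq_iff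
  obtain ⟨d, b⟩ := x
  obtain ⟨d, rfl⟩ := m.rot.surjective d
  have hs := (sameCycle_tutteMap_faceNext_iff m c).2 (Or.inl h)
  rw [h] at hs
  have hT : m.tutteMap.rot (c, true) = (m.rev c, true) := by
    conv_lhs => rw [← h]
    rw [tutteMap_rot_apply, if_pos rfl]
  unfold flipRot
  rw [tutteMap_rev, Bool.not_false, if_neg (not_not.2 hs), tutteMap_rot_false, h, if_pos rfl,
    tutteMap_faceNext_false, tutteMap_faceNext_true, h3,
    insertBefore_apply (detach_apply_self _ _), detach_apply, tutteMap_rot_apply]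
  cases s
  · simp only [rotateEquiv_apply, Prod.mk.injEq, hT]
    cases b <;> simp only [Bool.false_eq_true, and_false, and_true, if_false, if_true] <;>
      split_ifs <;> (try simp only [rotateEquiv_apply]) <;> (try split_ifs) <;>
      simp only [eq_tutteMap_rot_iff, rotate_rev, rotate_plus_rot_apply, h3, detach_apply] <;>
      grind
  · simp only [rotateEquiv_apply, Prod.mk.injEq, hT]
    cases b <;> simp only [Bool.false_eq_true, and_false, and_true, if_false, if_true] <;>
      split_ifs <;> (try simp only [rotateEquiv_apply]) <;> (try split_ifs) <;>
      simp only [eq_tutteMap_rot_iff, rotate_rev, rotate_minus_rot_apply, h3, detach_apply] <;>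
      grind

/-- The face of the corner `rev a` has degree 1. The vertex drawn in it is kept by the flip and
becomes the new vertex of degree 1 of the rotated map, so the colours are exchanged. -/
theorem flipRot_tutteMap_of_rot_eq_rev (m : RootedMap D) {a : D} (h : m.rot a = m.rev a)
    (s : Dir) (x : D × Bool) :
    rotateEquiv (m.rev a) (match s with | .plus => m.rev a | .minus => a) true
        (m.tutteMap.flipRot (m.rev a, false) s x) =
      (m.rotate (m.rev a) s).tutteMap.rot
        (rotateEquiv (m.rev a) (match s with | .plus => m.rev a | .minus => a) true x) := by
  have h1 := m.rev_rev
  have h2 := m.rev_ne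
  have h3 : m.rot⁻¹ (m.rev a) = a := by rw [Perm.inv_eq_iff_eq, h]
  have h4 : ∀ x y, m.rot x = m.rot y ↔ x = y := fun x y => m.rot.injective.eq_iff
  obtain ⟨d, b⟩ := x
  obtain ⟨d, rfl⟩ := m.rot.surjective d
  have hs := (sameCycle_tutteMap_faceNext_iff m a).2 (Or.inr h)
  have hne : m.rot (m.rev a) ≠ m.rev a := by grind
  rw [h] at hs
  have hT : m.tutteMap.rot (m.rev a, true) = (m.rev a, true) := by
    rw [← h, tutteMap_rot_apply, if_pos rfl, h]
  unfold flipRot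
  rw [tutteMap_rev, Bool.not_false, if_neg (not_not.2 hs), tutteMap_rot_false, hT, if_pos rfl,
    if_neg (by simpa using hne), tutteMap_faceNext_true, tutteMap_faceNext_false,
    show m.rot⁻¹ (m.rot (m.rev a)) = m.rev a from m.rot.symm_apply_apply _,
    insertBefore_apply (detach_apply_self _ _), detach_apply, tutteMap_rot_apply]
  cases s
  · simp only [rotateEquiv_apply, Prod.mk.injEq, tutteMap_rot_false]
    cases b <;> simp only [Bool.false_eq_true, and_true, if_false, if_true] <;>
      split_ifs <;> (try simp only [rotateEquiv_apply]) <;> (try split_ifs) <;>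
      simp only [eq_tutteMap_rot_iff, rotate_rev, rotate_plus_rot_apply, h3, detach_apply] <;>
      grind
  · simp only [rotateEquiv_apply, Prod.mk.injEq, tutteMap_rot_false]
    cases b <;> simp only [Bool.false_eq_true, and_true, if_false, if_true] <;>
      split_ifs <;> (try simp only [rotateEquiv_apply]) <;> (try split_ifs) <;>
      simp only [eq_tutteMap_rot_iff, rotate_rev, rotate_minus_rot_apply, h3, detach_apply] <;>
      grind

/-- The rotation system after the flip of an edge with distinct faces on its two sides. -/
theorem flipRot_tutteMap_apply (m : RootedMap D) {a : D} (h : m.rot a ≠ a)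
    (h' : m.rot a ≠ m.rev a) (s : Dir) (d : D) (b : Bool) :
    m.tutteMap.flipRot (m.rot a, false) s (m.rot d, b) =
      match s, b with
      | .plus, false => if d = a then (m.rev (m.rot a), true) else
          if m.rot d = m.rev a then (m.rot a, true) else
          if m.rot d = a then (m.rot (m.rot a), false) else (m.rot (m.rot d), false)
      | .plus, true => if d = a then (m.rot (m.rev a), false) else
          if d = m.rot a then (m.rot a, false) else
          if m.rev d = m.rot a then (m.rev a, true) else (m.rev d, true)
      | .minus, false => if d = a then (m.rot (m.rev (m.rot a)), false) else
          if m.rot d = m.rev (m.rot a) then (m.rot a, false) else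
          if m.rot d = a then (m.rot (m.rot a), false) else (m.rot (m.rot d), false)
      | .minus, true => if d = a then (a, true) else
          if d = m.rev a then (m.rot a, true) else
          if m.rev d = m.rot a then (m.rev a, true) else (m.rev d, true) := by
  have h1 := m.rev_rev
  have h2 := m.rev_ne
  have h4 : ∀ x y, m.rot x = m.rot y ↔ x = y := fun x y => m.rot.injective.eq_iff
  have f2 : ∀ d, m.tutteMap.faceNext (d, true) = (m.rot d, false) := fun _ => rfl
  have f3 : ∀ d, m.tutteMap.faceNext (m.rot d, false) = (m.rev d, true) := fun d => by
    rw [tutteMap_faceNext_false, show m.rot⁻¹ (m.rot d) = d from m.rot.symm_apply_apply d]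
  have hs := mt (sameCycle_tutteMap_faceNext_iff m a).1 (not_or.2 ⟨h, h'⟩)
  have ne2 : m.rev (m.rot a) ≠ a := fun h5 => h' (by rw [← h1 (m.rot a), h5])
  have ne3 : m.rot (m.rev a) ≠ m.rot a := fun h5 => h2 a ((h4 _ _).1 h5)
  unfold flipRot
  rw [tutteMap_rev, Bool.not_false, if_pos hs]
  cases s
  · simp only [flipTarget, f2, f3]
    rw [insertBefore_apply]
    · simp only [insertBefore_apply (detach_apply_self _ _)]
      cases b
      · simp only [detach_apply, tutteMap_rot_apply, Prod.mk.injEq, h4, Bool.false_eq_true,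
          reduceCtorEq, and_false, and_true, if_false, if_true]
        split_ifs <;> grind
      · simp only [detach_apply, tutteMap_rot_apply, Prod.mk.injEq, h4, Bool.false_eq_true,
          reduceCtorEq, and_false, and_true, if_false, if_true]
        split_ifs <;> grind
    · rw [insertBefore_apply (detach_apply_self _ _)]
      simp [detach_apply, h4, (h2 a).symm]
  · simp only [flipTarget, f2, f3, h1]
    rw [insertBefore_apply]
    · simp only [insertBefore_apply (detach_apply_self _ _)]
      cases b
      · simp only [detach_apply, tutteMap_rot_apply, Prod.mk.injEq, h4, Bool.false_eq_true,
          reduceCtorEq, and_false, and_true, if_false, if_true]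
        split_ifs <;> grind
      · simp only [detach_apply, tutteMap_rot_apply, Prod.mk.injEq, h4, Bool.false_eq_true,
          reduceCtorEq, and_false, and_true, if_false, if_true]
        split_ifs <;> grind
    · rw [insertBefore_apply (detach_apply_self _ _)]
      simp [detach_apply, h]

/-- In `flipTarget`, `plus` moves the head one step along the hexagon, to the other colour, whereas
`minus` moves it two steps and so names the counterclockwise flip with its ends exchanged, keeping
the colours. Hence the flag is `true` for `plus` only. -/
theorem flipRot_tutteMap_of_ne (m : RootedMap D) {a : D} (h : m.rot a ≠ a)
    (h' : m.rot a ≠ m.rev a) (s : Dir) (x : D × Bool) :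
    rotateEquiv (m.rot a) (match s with | .plus => m.rev a | .minus => a)
        (match s with | .plus => true | .minus => false)
        (m.tutteMap.flipRot (m.rot a, false) s x) =
      (m.rotate (m.rot a) s).tutteMap.rot
        (rotateEquiv (m.rot a) (match s with | .plus => m.rev a | .minus => a)
          (match s with | .plus => true | .minus => false) x) := by
  have h1 := m.rev_rev
  have h2 := m.rev_ne
  have h3 : m.rot⁻¹ (m.rot a) = a := m.rot.symm_apply_apply a
  have h4 : ∀ x y, m.rot x = m.rot y ↔ x = y := fun x y => m.rot.injective.eq_iff
  obtain ⟨d, b⟩ := x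
  obtain ⟨d, rfl⟩ := m.rot.surjective d
  rw [flipRot_tutteMap_apply m h h']
  cases s <;> cases b <;> simp only [rotateEquiv_apply] <;> split_ifs <;>
    simp only [rotateEquiv_apply] <;> (try split_ifs) <;>
    simp only [eq_tutteMap_rot_iff, rotate_rev, rotate_plus_rot_apply, rotate_minus_rot_apply, h3,
      detach_apply] <;>
    grind

end Flip
-- Flips and rotations: the root and the three cases together
section Flip

variable {D : Type*} [DecidableEq D]

theorem rotateEquiv_root (m : RootedMap D) {c : D} (hc : c ≠ m.root) (s : Dir) (k : Bool) :
    rotateEquiv c (match s with | .plus => m.rev (m.rot⁻¹ c) | .minus => m.rot⁻¹ c) k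
      (m.root, false) = ((m.rotate c s).root, false) := by
  rw [rotateEquiv_apply, if_neg hc.symm]
  cases s <;> exact (apply_ite (fun d => (d, false)) _ _ _).symm

theorem flipDart_tutteMap_iso (m : RootedMap D) {c : D} (hc : c ≠ m.root) (s : Dir) :
    (m.tutteMap.flipDart (c, false) s).Iso (m.rotate c s).tutteMap := by
  have hroot := rotateEquiv_root m hc s
  obtain ⟨a, rfl⟩ := m.rot.surjective c
  have h3 : m.rot⁻¹ (m.rot a) = a := m.rot.symm_apply_apply a
  rw [h3] at hroot
  by_cases h : m.rot a = a
  · rw [h] at hroot ⊢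
    exact ⟨_, isIso_rotateEquiv (m := m) _ _ true rfl (hroot true)
      (flipRot_tutteMap_of_rot_eq_self m h s)⟩
  by_cases h' : m.rot a = m.rev a
  · rw [h'] at hroot ⊢
    exact ⟨_, isIso_rotateEquiv (m := m) _ _ true rfl (hroot true)
      (flipRot_tutteMap_of_rot_eq_rev m h' s)⟩
  · exact ⟨_, isIso_rotateEquiv (m := m) _ _ _ rfl (hroot _) (flipRot_tutteMap_of_ne m h h' s)⟩

end Flip

/-! ### Tutte's mapping is injective -/

section Injective

variable {D D' : Type*}

theorem IsIso.isPlanarMap {m : RootedMap D} {m' : RootedMap D'} {g : D ≃ D'} (h : m.IsIso m' g)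
    (hm : m.IsPlanarMap) : m'.IsPlanarMap := by
  rw [h.eq_relabel]; exact hm.relabel g

theorem IsIso.isQuadrangulation {m : RootedMap D} {m' : RootedMap D'} {g : D ≃ D'}
    (h : m.IsIso m' g) (hm : m.IsQuadrangulation) : m'.IsQuadrangulation := by
  rw [h.eq_relabel]; exact hm.relabel g

/-- An isomorphism between Tutte's quadrangulations preserves the colours of the vertices. -/
theorem IsIso.tutteMap_snd {m : RootedMap D} {m' : RootedMap D'} {g : D × Bool ≃ D' × Bool}
    (h : m.tutteMap.IsIso m'.tutteMap g) (hm : m.IsConnected) (x : D × Bool) :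
    (g x).2 = x.2 := by
  -- The colour discrepancy is unchanged by `rot` and by `rev`, hence constant, and it vanishes at
  -- the root.
  have hE := (tutteMap_connected hm).rel (Setoid.ker fun x => (g x).2 ^^ x.2) (fun x => ?_)
    (fun x => ?_) x m.tutteMap.root
  · have hE' : ((g x).2 ^^ x.2) = ((g m.tutteMap.root).2 ^^ m.tutteMap.root.2) := hE
    rw [h.root] at hE'
    have : ((g x).2 ^^ x.2) = false := hE'
    simpa using this
  · change ((g x).2 ^^ x.2) = ((g _).2 ^^ _)
    rw [h.rot]; rfl
  · change ((g x).2 ^^ x.2) = ((g _).2 ^^ _)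
    rw [h.rev]
    change _ = (!(g x).2 ^^ !x.2)
    simp

theorem iso_of_tutteMap_iso {m : RootedMap D} {m' : RootedMap D'} (hm : m.IsConnected)
    (h : m.tutteMap.Iso m'.tutteMap) : m.Iso m' := by
  obtain ⟨g, h⟩ := h
  have hs := h.tutteMap_snd hm
  have hs' : ∀ y, (g.symm y).2 = y.2 := fun y => by rw [← hs, apply_symm_apply]
  have e1 : ∀ d, g (d, false) = ((g (d, false)).1, false) := fun d => Prod.ext rfl (hs _)
  have e2 : ∀ d, g (d, true) = ((g (d, false)).1, true) := fun d => by
    have := h.rev (d, false)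
    rw [e1] at this
    exact this
  let f : D ≃ D' :=
    { toFun := fun d => (g (d, false)).1
      invFun := fun d => (g.symm (d, false)).1
      left_inv := fun d => by
        dsimp only
        rw [← e1, symm_apply_apply]
      right_inv := fun d => by
        have : ((g.symm (d, false)).1, false) = g.symm (d, false) := Prod.ext rfl (hs' (d, false)).symm
        dsimp only
        rw [this, apply_symm_apply] }
  have hrot : ∀ d, f (m.rot d) = m'.rot (f d) := fun d => by
    have := h.rot (d, false)
    rw [e1 d] at this
    exact congrArg Prod.fst this
  have hface : ∀ d, f (m.faceNext d) = m'.faceNext (f d) := fun d => by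
    have := h.rot (m.faceNext d, true)
    rw [e2 (m.faceNext d), tutteMap_rot_true, tutteMap_rot_true,
      show m.faceNext⁻¹ (m.faceNext d) = d from m.faceNext.symm_apply_apply d, e2 d,
      Prod.mk.injEq, Perm.eq_inv_iff_eq] at this
    exact this.1.symm
  -- `f` commutes with `rev` because `rev = rot⁻¹ * faceNext`.
  refine ⟨f, hrot, fun d => ?_, congrArg Prod.fst h.root⟩
  have := hface d
  rw [faceNext_apply, faceNext_apply, hrot] at this
  exact m'.rot.injective this

end Injective
/-! ### Planar quadrangulations are bipartite -/

section Bipartite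

variable {D : Type*}

theorem sum_edge [Fintype D] (m : RootedMap D) [Fintype m.Edge] {M : Type*} [AddCommMonoid M]
    (F : m.Edge → M) (h : D → M) (hF : ∀ d, F (m.edge d) = h d + h (m.rev d)) :
    ∑ e, F e = ∑ d, h d := by
  classical
  rw [← Finset.sum_fiberwise (s := Finset.univ) (g := m.edge)]
  refine Finset.sum_congr rfl ?_
  rintro ⟨d⟩ -
  have : (Finset.univ.filter fun x => m.edge x = Quot.mk _ d) = {d, m.rev d} := by
    ext x
    simp only [Finset.mem_filter, Finset.mem_univ, true_and, Finset.mem_insert,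
      Finset.mem_singleton]
    rw [← m.sameCycle_rev_iff]
    exact ⟨fun h => (Quotient.exact h : m.rev.SameCycle x d).symm,
      fun h => Quotient.sound (h.symm : m.rev.SameCycle x d)⟩
  rw [this, Finset.sum_pair (m.rev_ne d).symm]
  exact hF d

/-- The coboundary mod 2 from the functions on the cycles of `p` (for instance on the vertices or
on the faces) to the functions on the edges. -/
def coboundary (m : RootedMap D) (p : Perm D) :
    (Quotient (Perm.SameCycle.setoid p) → ZMod 2) →ₗ[ZMod 2] (m.Edge → ZMod 2) where
  toFun f := Quotient.lift (fun d => f (Quotient.mk _ d) + f (Quotient.mk _ (m.rev d))) (by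
    intro a b h
    rcases (m.sameCycle_rev_iff a b).1 h with rfl | rfl
    · rfl
    · simp only [m.rev_rev]; exact add_comm _ _)
  map_add' f g := by
    ext ⟨d⟩
    change f _ + g _ + (f _ + g _) = f _ + f _ + (g _ + g _)
    ring
  map_smul' c f := by
    ext ⟨d⟩
    change c * f _ + c * f _ = c * (f _ + f _)
    ring

theorem coboundary_edge (m : RootedMap D) (p : Perm D)
    (f : Quotient (Perm.SameCycle.setoid p) → ZMod 2) (d : D) :
    m.coboundary p f (m.edge d) = f (Quotient.mk _ d) + f (Quotient.mk _ (m.rev d)) := rfl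

theorem mk_apply (p : Perm D) (d : D) :
    Quotient.mk (Perm.SameCycle.setoid p) (p d) = Quotient.mk _ d :=
  Quotient.sound (s := Perm.SameCycle.setoid p) (Perm.SameCycle.symm ⟨1, by simp⟩)

/-- The kernel of the coboundary consists of the constant functions. -/
theorem card_le_finrank_range_coboundary [Finite D] {m : RootedMap D} {p : Perm D}
    (h : ∀ E : Setoid D, (∀ x, E x (p x)) → (∀ x, E x (m.rev x)) → ∀ x y, E x y) :
    Nat.card (Quotient (Perm.SameCycle.setoid p)) ≤
      Module.finrank (ZMod 2) (LinearMap.range (m.coboundary p)) + 1 := by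
  have : Finite (Quotient (Perm.SameCycle.setoid p)) := Quotient.finite _
  have : Fintype (Quotient (Perm.SameCycle.setoid p)) := Fintype.ofFinite _
  have hk : LinearMap.ker (m.coboundary p) ≤ Submodule.span (ZMod 2) {fun _ => 1} := by
    intro f hf
    have hf' : ∀ d, f (Quotient.mk _ d) + f (Quotient.mk _ (m.rev d)) = 0 := fun d => by
      rw [← coboundary_edge, LinearMap.mem_ker.1 hf]; rfl
    have hc := h (Setoid.ker fun d => f (Quotient.mk _ d))
      (fun x => (congrArg f (mk_apply p x)).symm)
      (fun x => by
        change f _ = f _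
        exact CharTwo.add_eq_zero.1 (hf' x))
    rw [Submodule.mem_span_singleton]
    refine ⟨f (Quotient.mk _ m.root), ?_⟩
    ext ⟨d⟩
    change f _ * 1 = _
    rw [mul_one]
    exact hc m.root d
  have h1 := (Submodule.finrank_mono hk).trans (finrank_span_le_card _)
  have h2 := LinearMap.finrank_range_add_finrank_ker (m.coboundary p)
  rw [Module.finrank_fintype_fun_eq_card] at h2
  rw [Nat.card_eq_fintype_card]
  simp at h1
  omega

/-- Cuts of the graph are orthogonal to cuts of the dual. Expanded over darts, the sum has a term
for each corner paired with its vertex and face; each occurs twice, since `rot d` and `rev d` lie in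
the same face, and cancels mod 2. -/
theorem sum_coboundary_mul_coboundary [Fintype D] (m : RootedMap D) [Fintype m.Edge]
    (f : Quotient (Perm.SameCycle.setoid m.rot) → ZMod 2)
    (k : Quotient (Perm.SameCycle.setoid m.faceNext) → ZMod 2) :
    ∑ e, m.coboundary m.faceNext k e * m.coboundary m.rot f e = 0 := by
  rw [m.sum_edge _ (fun d => k (Quotient.mk _ d) * f (Quotient.mk _ d) +
    k (Quotient.mk _ (m.rev d)) * f (Quotient.mk _ d)), Finset.sum_add_distrib,
    ← Equiv.sum_comp m.rot fun d => k (Quotient.mk _ d) * f (Quotient.mk _ d)]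
  · rw [← Finset.sum_add_distrib]
    refine Finset.sum_eq_zero fun d _ => ?_
    have h1 : k (Quotient.mk _ (m.rot d)) = k (Quotient.mk _ (m.rev d)) := by
      rw [← mk_apply m.faceNext (m.rev d), faceNext_apply, m.rev_rev]
    rw [h1, show f (Quotient.mk _ (m.rot d)) = f (Quotient.mk _ d) from
      congrArg f (mk_apply m.rot d), CharTwo.add_self_eq_zero]
  · intro d
    rw [coboundary_edge, coboundary_edge, m.rev_rev]
    ring

/-- In a planar map all of whose faces have even degree, the ends of the edges can be
distinguished by a function on the vertices. -/
theorem IsPlanarMap.exists_coboundary_eq_one [Fintype D] {m : RootedMap D} (h : m.IsPlanarMap)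
    (hsum : ∀ k : Quotient (Perm.SameCycle.setoid m.faceNext) → ZMod 2,
      ∑ d, k (Quotient.mk _ d) = 0) :
    ∃ f, m.coboundary m.rot f = fun _ => 1 := by
  classical
  have : Finite m.Edge := Quotient.finite _
  set W := (LinearMap.range (m.coboundary m.faceNext)).map
    (dotProductEquiv (ZMod 2) m.Edge).toLinearMap with hW
  have hV := card_le_finrank_range_coboundary (m := m) (p := m.rot)
    ((isConnected_iff m).1 h.connected)
  have hF := card_le_finrank_range_coboundary (m := m) (p := m.faceNext) fun E h1 h2 =>
    (isConnected_iff m).1 h.connected E (fun x => by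
      have := h1 (m.rev x)
      rw [faceNext_apply, m.rev_rev] at this
      exact E.trans (h2 x) this) h2
  have hmem : ∀ g : m.Edge → ZMod 2, g ∈ W.dualCoannihilator ↔
      ∀ k, ∑ e, m.coboundary m.faceNext k e * g e = 0 := by
    intro g
    rw [Submodule.mem_dualCoannihilator]
    constructor
    · intro hg k
      exact hg _ ⟨_, ⟨k, rfl⟩, rfl⟩
    · rintro hg _ ⟨_, ⟨k, rfl⟩, rfl⟩
      exact hg k
  have hle : LinearMap.range (m.coboundary m.rot) ≤ W.dualCoannihilator := by
    rintro _ ⟨f, rfl⟩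
    exact (hmem _).2 fun k => m.sum_coboundary_mul_coboundary f k
  have hdim := Subspace.finrank_add_finrank_dualCoannihilator_eq W
  rw [hW, LinearEquiv.finrank_map_eq, ← hW, Module.finrank_fintype_fun_eq_card,
    ← Nat.card_eq_fintype_card] at hdim
  have he := h.euler
  -- The complement has dimension at most `E - (F - 1)`, which is `V - 1` by Euler's formula, and
  -- the range of the vertex coboundary has dimension at least `V - 1`.
  have heq := Submodule.eq_of_le_of_finrank_le hle (by
    unfold Vertex Face at he
    omega)
  have h1 : (fun _ => 1 : m.Edge → ZMod 2) ∈ W.dualCoannihilator := by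
    refine (hmem _).2 fun k => ?_
    simp only [mul_one]
    rw [m.sum_edge _ (fun d => k (Quotient.mk _ d)) (fun d => m.coboundary_edge _ k d)]
    exact hsum k
  rw [← heq] at h1
  exact h1

theorem faceNext_pow_four {m : RootedMap D} (h : ∀ d, m.faceDegree d = 4) (d : D) :
    m.faceNext (m.faceNext (m.faceNext (m.faceNext d))) = d := by
  have := Function.isPeriodicPt_minimalPeriod m.faceNext d
  rw [show Function.minimalPeriod m.faceNext d = 4 from h d] at this
  exact this

theorem IsQuadrangulation.exists_coloring [Finite D] {q : RootedMap D}
    (h : q.IsQuadrangulation) :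
    ∃ f : D → Bool, (∀ d, f (q.rot d) = f d) ∧ (∀ d, f (q.rev d) = !f d) ∧ f q.root = false := by
  classical
  have : Fintype D := Fintype.ofFinite D
  obtain ⟨f, hf⟩ := h.toIsPlanarMap.exists_coboundary_eq_one fun k => by
    -- Opposite darts of a face of degree 4 are paired and cancel mod 2.
    refine Finset.sum_involution (fun d _ => q.faceNext (q.faceNext d)) (fun d _ => ?_)
      (fun d _ _ => flipTarget_ne h.degree d .plus) (fun _ _ => Finset.mem_univ _)
      (fun d _ => faceNext_pow_four h.degree d)
    rw [mk_apply, mk_apply, CharTwo.add_self_eq_zero]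
  have hadd : ∀ d, f (Quotient.mk _ d) + f (Quotient.mk _ (q.rev d)) = 1 := fun d => by
    rw [← coboundary_edge, hf]
  have key : ∀ a b r : ZMod 2, a + b = 1 → decide (b ≠ r) = !decide (a ≠ r) := by decide
  -- Comparison with the value at the root normalises the colour of the root to `false`.
  refine ⟨fun d => decide (f (Quotient.mk _ d) ≠ f (Quotient.mk _ q.root)), fun d => ?_,
    fun d => key _ _ _ (hadd d), by simp⟩
  simp only [mk_apply]

end Bipartite
/-! ### Tutte's mapping is surjective -/

section Surjective

variable {D : Type*}

/-- The map on the vertices of colour `false` of a bipartite quadrangulation, whose edges are the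
diagonals of the faces. -/
def diagonalMap (q : RootedMap D) (h : ∀ d, q.faceDegree d = 4) (f : D → Bool)
    (hrot : ∀ d, f (q.rot d) = f d) (hrev : ∀ d, f (q.rev d) = !f d) (hroot : f q.root = false) :
    RootedMap {d // f d = false} where
  rot := q.rot.subtypePerm fun d => by rw [hrot]
  rev := (q.rev * q.faceNext * q.faceNext * q.rev).subtypePerm fun d => by
    simp [faceNext_apply, hrot, hrev]
  rev_rev := by
    rintro ⟨d, hd⟩
    simp [q.rev_rev, faceNext_pow_four h]
  rev_ne := by
    rintro ⟨d, hd⟩ h'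
    have h1 : q.rev (q.faceNext (q.faceNext (q.rev d))) = d := congrArg Subtype.val h'
    classical
    apply flipTarget_ne h (q.rev d) .plus
    change q.faceNext (q.faceNext (q.rev d)) = q.rev d
    conv_rhs => rw [← h1]
    rw [q.rev_rev]
  root := ⟨q.root, hroot⟩

/-- The darts of a bipartite map, enumerated by the darts issued from a vertex of colour `false`
and by their reverses. -/
def bipartiteEquiv (q : RootedMap D) (f : D → Bool) (hrev : ∀ d, f (q.rev d) = !f d) :
    {d // f d = false} × Bool ≃ D where
  toFun x := if x.2 then q.rev x.1 else x.1
  invFun d := if h : f d = false then (⟨d, h⟩, false) else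
    (⟨q.rev d, by rw [hrev]; simpa using h⟩, true)
  left_inv := by
    rintro ⟨⟨d, hd⟩, _ | _⟩
    · simp [hd]
    · simp [hrev, hd, q.rev_rev]
  right_inv := by
    intro d
    by_cases h : f d = false <;> simp [h, q.rev_rev]

/-- The darts issued from the root colour are the corners of the map of diagonals. No planarity of
`m` is claimed here; it follows from that of `q` by `isPlanarMap_of_tutteMap`. -/
theorem IsQuadrangulation.exists_tutteMap_isIso [Finite D] {q : RootedMap D}
    (h : q.IsQuadrangulation) :
    ∃ (p : D → Prop) (m : RootedMap {d // p d}) (g : {d // p d} × Bool ≃ D),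
      m.tutteMap.IsIso q g := by
  obtain ⟨f, hrot, hrev, hroot⟩ := h.exists_coloring
  refine ⟨_, q.diagonalMap h.degree f hrot hrev hroot, q.bipartiteEquiv f hrev, ?_, ?_, rfl⟩
  · rintro ⟨d, _ | _⟩
    · rfl
    · obtain ⟨c, rfl⟩ := (q.diagonalMap h.degree f hrot hrev hroot).rot.surjective d
      rw [tutteMap_rot_true, faceNext_inv_apply,
        show (q.diagonalMap h.degree f hrot hrev hroot).rot⁻¹
          ((q.diagonalMap h.degree f hrot hrev hroot).rot c) = c from symm_apply_apply _ _]
      change q.rev (q.rev (q.faceNext (q.faceNext (q.rev c)))) = q.rot (q.rev (q.rot c))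
      rw [q.rev_rev, faceNext_apply, faceNext_apply, q.rev_rev]
  · rintro ⟨d, _ | _⟩
    · rfl
    · exact (q.rev_rev d).symm

end Surjective

end MapChains.RootedMap

namespace MapChains

open Equiv RootedMap

variable {n : ℕ}

/-! ### Tutte's mapping as a bijection between isomorphism classes -/

theorem toMap_eq_iff {m m' : LabelledMap n} : m.toMap = m'.toMap ↔ m.1.Iso m'.1 :=
  ⟨fun h => Quotient.exact h, fun h => Quotient.sound h⟩

theorem tutte_toMap_eq_iff {m : LabelledMap n} {q : LabelledQuad n} :
    tutte n m.toMap = q.toQuad ↔ m.1.tutteMap.Iso q.1 :=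
  ⟨fun h => Iso.trans ⟨_, isIso_relabel _ _⟩ (Quotient.exact h),
    fun h => Quotient.sound (Iso.trans (Iso.symm ⟨_, isIso_relabel _ _⟩) h)⟩

theorem tutte_injective (n : ℕ) : Function.Injective (tutte n) := by
  rintro ⟨m⟩ ⟨m'⟩ h
  have h' := tutte_toMap_eq_iff (q := ⟨_, m'.2.tutteMap.relabel (dartEquiv n)⟩).1 h
  exact toMap_eq_iff.2 (iso_of_tutteMap_iso m.2.connected
    (h'.trans (Iso.symm ⟨_, isIso_relabel _ _⟩)))

theorem tutte_surjective (n : ℕ) : Function.Surjective (tutte n) := by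
  rintro ⟨q⟩
  obtain ⟨p, m, g, hg⟩ := q.2.exists_tutteMap_isIso
  have hcard : Nat.card {d // p d} = 2 * n := by
    have := Nat.card_congr g
    rw [Nat.card_prod, Nat.card_eq_fintype_card (α := Bool), Fintype.card_bool, Nat.card_fin]
      at this
    omega
  have hm := isPlanarMap_of_tutteMap (hg.symm.isPlanarMap q.2.toIsPlanarMap)
  let r : {d // p d} ≃ Fin (2 * n) := Finite.equivFinOfCardEq hcard
  exact ⟨LabelledMap.toMap ⟨m.relabel r, hm.relabel r⟩, tutte_toMap_eq_iff.2
    (Iso.trans ⟨_, (isIso_relabel m r).symm.tutteMap⟩ ⟨g, hg⟩)⟩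

/-- The inverse of Tutte's mapping. -/
noncomputable def tutteInv (n : ℕ) : Quadrangulation n ≃ PlanarMap n :=
  (Equiv.ofBijective _ ⟨tutte_injective n, tutte_surjective n⟩).symm

theorem tutteInv_toQuad_eq_iff {m : LabelledMap n} {q : LabelledQuad n} :
    tutteInv n q.toQuad = m.toMap ↔ m.1.tutteMap.Iso q.1 := by
  rw [← tutte_toMap_eq_iff, tutteInv, symm_apply_eq, eq_comm]; rfl

/-! ### Flips correspond to rotations -/

theorem edge_tutte_eq_iff {D D' : Type*} {m : RootedMap D} {q : RootedMap D'}
    {g : D × Bool ≃ D'} (h : m.tutteMap.IsIso q g) (c c' : D) :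
    q.edge (g (c', false)) = q.edge (g (c, false)) ↔ c' = c := by
  refine ⟨fun H => ?_, fun H => by rw [H]⟩
  have := (q.sameCycle_rev_iff _ _).1 (Quotient.exact H)
  rw [← h.rev, g.injective.eq_iff, g.injective.eq_iff] at this
  simpa [eq_comm] using this

theorem exists_edge_tutte_eq {D D' : Type*} {m : RootedMap D} {q : RootedMap D'}
    {g : D × Bool ≃ D'} (h : m.tutteMap.IsIso q g) (e : q.Edge) :
    ∃ c, e = q.edge (g (c, false)) := by
  obtain ⟨d⟩ := e
  obtain ⟨⟨c, b⟩, rfl⟩ := g.surjective d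
  refine ⟨c, Quotient.sound ((q.sameCycle_rev_iff _ _).2 ?_)⟩
  rw [← h.rev]
  cases b <;> simp

theorem tutteMap_rotate_iso_flip {D D' : Type*} [DecidableEq D] [DecidableEq D'] [Finite D]
    {m : RootedMap D} {q : RootedMap D'} {g : D × Bool ≃ D'} (hm : m.IsPlanarMap)
    (hq : q.IsQuadrangulation) (h : m.tutteMap.IsIso q g) {c : D} (hc : c ≠ m.root) (s : Dir) :
    (m.rotate c s).tutteMap.Iso (q.flip hq (q.edge (g (c, false))) s) :=
  (flipDart_tutteMap_iso m hc s).symm.trans (h.flip hm.tutteMap hq (c, false) s)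

/-! ### The Markov chains -/

theorem flipProb_eq_rotationProb {m m' : LabelledMap n} {q q' : LabelledQuad n}
    (h : m.1.tutteMap.Iso q.1) (h' : m'.1.tutteMap.Iso q'.1) :
    flipProb q q' = rotationProb m m' := by
  classical
  obtain ⟨g, hg⟩ := h
  -- Injectivity of Tutte's construction makes the indicators of the two sums agree term by term.
  have hiso : ∀ {a : RootedMap (Fin (2 * n))} {b : RootedMap (Fin (4 * n))},
      a.tutteMap.Iso b → (q'.1.Iso b ↔ m'.1.Iso a) := fun {a b} hab =>
    ⟨fun H => iso_of_tutteMap_iso m'.2.connected ((h'.trans H).trans hab.symm),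
      fun H => (h'.symm.trans ⟨_, H.choose_spec.tutteMap⟩).trans hab⟩
  unfold flipProb rotationProb
  congr 1
  symm
  refine Finset.sum_bij (fun c _ => q.1.edge (g (c, false))) (fun c hc => ?_)
    (fun c _ c' _ H => (edge_tutte_eq_iff hg c' c).1 H) (fun e he => ?_) (fun c hc => ?_)
  · rw [Finset.mem_filter] at hc ⊢
    refine ⟨Finset.mem_univ _, fun H => hc.2 ?_⟩
    rw [rootEdge, ← hg.root] at H
    exact (edge_tutte_eq_iff hg _ _).1 H
  · obtain ⟨c, rfl⟩ := exists_edge_tutte_eq hg e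
    refine ⟨c, ?_, rfl⟩
    rw [Finset.mem_filter] at he ⊢
    refine ⟨Finset.mem_univ _, fun H => he.2 ?_⟩
    rw [rootEdge, ← hg.root, H]; rfl
  · rw [Finset.mem_filter] at hc
    have key := tutteMap_rotate_iso_flip m.2 q.2 hg hc.2
    rw [hiso (key .plus), hiso (key .minus), hiso ⟨g, hg⟩]

theorem flipMatrix_apply (x y : Quadrangulation n) :
    flipMatrix n x y = rotationMatrix n (tutteInv n x) (tutteInv n y) := by
  obtain ⟨q⟩ := x
  obtain ⟨q'⟩ := y
  change flipMatrix n q.toQuad q'.toQuad =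
    rotationMatrix n (tutteInv n q.toQuad) (tutteInv n q'.toQuad)
  obtain ⟨m, hm⟩ : ∃ m : LabelledMap n, tutteInv n q.toQuad = m.toMap :=
    ⟨_, (Quotient.out_eq _).symm⟩
  obtain ⟨m', hm'⟩ : ∃ m' : LabelledMap n, tutteInv n q'.toQuad = m'.toMap :=
    ⟨_, (Quotient.out_eq _).symm⟩
  rw [hm, hm']
  exact flipProb_eq_rotationProb (tutteInv_toQuad_eq_iff.1 hm) (tutteInv_toQuad_eq_iff.1 hm')

theorem ind_nonneg (P : Prop) : 0 ≤ ind P := by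
  unfold ind; split_ifs <;> norm_num

/-- Planarity makes `a` represent a class, and only this class contributes. Row sums are 1 because
rotations stay among planar maps. -/
theorem sum_ind_iso {a : RootedMap (Fin (2 * n))} (ha : a.IsPlanarMap) :
    ∑ y : PlanarMap n, ind (y.out.1.Iso a) = 1 := by
  rw [Finset.sum_eq_single (LabelledMap.toMap ⟨a, ha⟩)]
  · have h : (LabelledMap.toMap ⟨a, ha⟩ : PlanarMap n).out.1.Iso a :=
      Quotient.exact (Quotient.out_eq (LabelledMap.toMap ⟨a, ha⟩ : PlanarMap n))
    rw [ind, if_pos h]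
  · intro y _ hy
    rw [ind, if_neg]
    intro h
    exact hy (by rw [← Quotient.out_eq y]; exact Quotient.sound h)
  · exact fun h => absurd (Finset.mem_univ _) h

theorem rotationMatrix_mem_rowStochastic (hn : 1 ≤ n) :
    rotationMatrix n ∈ Matrix.rowStochastic ℝ (PlanarMap n) := by
  have hn' : (1 : ℝ) ≤ n := by exact_mod_cast hn
  rw [Matrix.mem_rowStochastic_iff_sum]
  constructor
  · rintro ⟨m⟩ ⟨m'⟩
    refine mul_nonneg (one_div_nonneg.2 (by linarith)) (Finset.sum_nonneg fun c _ => ?_)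
    exact add_nonneg (add_nonneg (ind_nonneg _) (ind_nonneg _)) (ind_nonneg _)
  · rintro ⟨m⟩
    have h : ∀ y : PlanarMap n, rotationMatrix n (Quotient.mk _ m) y = rotationProb m y.out :=
      fun y => by
        conv_lhs => rw [← Quotient.out_eq y]
        rfl
    change ∑ y, rotationMatrix n (Quotient.mk _ m) y = 1
    simp only [h, rotationProb]
    rw [← Finset.mul_sum, Finset.sum_comm]
    simp only [Finset.sum_add_distrib, sum_ind_iso (m.2.rotate _ _), sum_ind_iso m.2]
    -- Each of the `2n - 1` non-root corners contributes 3; `1 ≤ n` makes the normalising factor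
    -- nonzero.
    rw [Finset.sum_const, Finset.filter_ne', Finset.card_erase_of_mem (Finset.mem_univ _),
      Finset.card_univ, Fintype.card_fin]
    rw [nsmul_eq_mul, Nat.cast_sub (by omega)]
    push_cast
    have h2 : (2 * n - 1 : ℝ) ≠ 0 := by linarith
    field_simp
    norm_num

theorem flipMatrix_mem_rowStochastic (hn : 1 ≤ n) :
    flipMatrix n ∈ Matrix.rowStochastic ℝ (Quadrangulation n) := by
  have h := rotationMatrix_mem_rowStochastic hn
  rw [Matrix.mem_rowStochastic_iff_sum] at h ⊢
  refine ⟨fun x y => by rw [flipMatrix_apply]; exact h.1 _ _, fun x => ?_⟩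
  simp only [flipMatrix_apply]
  rw [Equiv.sum_comp (tutteInv n) (rotationMatrix n (tutteInv n x))]
  exact h.2 _

end MapChains

/-- `Φ` is the inverse of Tutte's mapping `tutte n`; it maps
quadrangulations to maps.  If `m` is the map `Φ q`, then the (unique) isomorphism `g` from Tutte's
construction on `m` to `q` makes the edge `e` of `q` correspond to the corner `c` of `m` that this
edge is issued from. -/
theorem mainTheorem2 (n : ℕ) (hn : 1 ≤ n) :
    ∃ Φ : Quadrangulation n ≃ PlanarMap n,
      (∀ x : PlanarMap n, Φ.symm x = tutte n x) ∧
      (∀ (q : LabelledQuad n) (m : LabelledMap n), Φ q.toQuad = m.toMap →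
        (∃ g : Fin (2 * n) × Bool ≃ Fin (4 * n), m.1.tutteMap.IsIso q.1 g) ∧
        ∀ g : Fin (2 * n) × Bool ≃ Fin (4 * n), m.1.tutteMap.IsIso q.1 g →
          ∀ e : q.1.Edge, e ≠ q.1.rootEdge →
            ∃ c : Fin (2 * n), (∀ c' : Fin (2 * n), q.1.edge (g (c', false)) = e ↔ c' = c) ∧
              c ≠ m.1.root ∧
              ∀ s : Dir, ∃ (hq : (q.1.flip q.2 e s).IsQuadrangulation)
                (hm : (m.1.rotate c s).IsPlanarMap),
                Φ (LabelledQuad.toQuad ⟨q.1.flip q.2 e s, hq⟩) =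
                  LabelledMap.toMap ⟨m.1.rotate c s, hm⟩) ∧
      flipMatrix n ∈ Matrix.rowStochastic ℝ (Quadrangulation n) ∧
      rotationMatrix n ∈ Matrix.rowStochastic ℝ (PlanarMap n) ∧
      ∀ x y : Quadrangulation n, flipMatrix n x y = rotationMatrix n (Φ x) (Φ y) := by
  refine ⟨tutteInv n, fun _ => rfl, fun q m hqm => ⟨tutteInv_toQuad_eq_iff.1 hqm, ?_⟩,
    flipMatrix_mem_rowStochastic hn, rotationMatrix_mem_rowStochastic hn, flipMatrix_apply⟩
  intro g hg e he
  obtain ⟨c, rfl⟩ := exists_edge_tutte_eq hg e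
  have hc : c ≠ m.1.root := by
    rintro rfl
    exact he (by rw [RootedMap.rootEdge, ← hg.root]; rfl)
  refine ⟨c, fun c' => edge_tutte_eq_iff hg c c', hc, fun s => ?_⟩
  have h := tutteMap_rotate_iso_flip m.2 q.2 hg hc s
  have hm := m.2.rotate c s
  -- The flipped map inherits planarity and face degrees from the Tutte quadrangulation of the
  -- rotated map.
  have hq := h.choose_spec.isQuadrangulation hm.tutteMap
  exact ⟨hq, hm, tutteInv_toQuad_eq_iff.2 h⟩
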